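/- Let $d\in\mathbb N$, let $\mathbb F^d$ be the free monoid of words in $d$ letters (unit: the empty word $\emptyset$), let $\mathbb H^2_d=\ell^2(\mathbb F^d)$ be the full Fock space with orthonormal basis $(e_\alpha)_{\alpha\in\mathbb F^d}$ and vacuum vector $1=e_\emptyset$, and let $L_k e_\alpha=e_{k\alpha}$ ($1\le k\le d$) be the left free shifts, with $L^\alpha=L_{i_1}\cdots L_{i_n}$ for $\alpha=i_1\cdots i_n$. Let $\mathcal A_d$ be the operator-norm closure of the unital algebra generated by $L_1,\dots,L_d$, and let $\mathscr A_d$ be the norm closure of $\mathcal A_d+\mathcal A_d^*$. An NC measure is a positive linear functional on $\mathscr A_d$; NC Lebesgue measure is the vacuum state $m(x)=\langle 1,x1\rangle$. Inner products are conjugate linear in the first argument. For an NC measure $\mu$ let $q_\mu(a_1,a_2)=\mu(a_1^*a_2)$, $a_1,a_2\in\mathcal A_d$ (one has $\mathcal A_d^*\mathcal A_d\subseteq\mathscr A_d$), regarded as a positive semi-definite form in $\mathbb H^2_d$ with dense domain $\mathcal A_d\subset\mathbb H^2_d$ via $a\mapsto a1$. A densely defined positive semi-definite form $q$ in a Hilbert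 space is closed if its domain is complete in the norm $(q(x,x)+\|x\|^2)^{1/2}$, and closable if it has a closed extension. The measure $\mu$ is absolutely continuous if $q_\mu$ is closable. Let $\mathbb B^d_{\mathbb N}=\bigsqcup_{n\ge1}\{Z=(Z_1,\dots,Z_d)\in(\mathbb C^{n\times n})^d:\ \sum_k Z_kZ_k^*<I_n\}$, and let $Z^\alpha=Z_{i_1}\cdots Z_{i_n}$ for $\alpha=i_1\cdots i_n$. The NC Hardy space $H^2(\mathbb B^d_{\mathbb N})$ is the space of all functions $f(Z)=\sum_\alpha \hat f_\alpha Z^\alpha$ on $\mathbb B^d_{\mathbb N}$ with $\sum_\alpha|\hat f_\alpha|^2<\infty$. For an NC measure $\mu$ put $$H_\mu(Z)=\mu(I)I_n+2\sum_{\alpha\ne\emptyset}\overline{\mu(L^\alpha)}\,Z^\alpha,\qquad K^\mu(Z,W)[P]=\frac12\sum_{\alpha}Z^\alpha\bigl(H_\mu(Z)P+PH_\mu(W)^*\bigr)(W^\alpha)^*$$ for $Z,W\in\mathbb B^d_{\mathbb N}$ of sizes $n$ and $n'$ and $P\in\mathbb C^{n\times n'}$. The free Herglotz space $\mathscr H^+(H_\mu)$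 is the non-commutative reproducing kernel Hilbert space with kernel $K^\mu$: the Hilbert space of functions $f$ on $\mathbb B^d_{\mathbb N}$, with values in $\mathbb C^{n\times n}$ at level $n$, in which the vectors $K^\mu\{Z,y,v\}$ ($Z$ of size $n$, $y,v\in\mathbb C^n$) determined by $\langle K^\mu\{Z,y,v\},f\rangle=y^*f(Z)v$ exist, have dense linear span and satisfy $\langle K^\mu\{Z,y,v\},K^\mu\{W,x,u\}\rangle=y^*\,K^\mu(Z,W)[vu^*]\,x$. Given an NC measure $\mu$, the following are equivalent: 1. $\mu$ is absolutely continuous. 2. The intersection $\mathscr H^+(H_{\mu+m})\cap H^2(\mathbb B^d_{\mathbb N})$ is dense in $\mathscr H^+(H_{\mu+m})$. -/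

import Mathlib

open scoped ComplexOrder
namespace FreeHardy

/-- The free monoid of words in the letters `Fin d`; its unit is the empty word. -/
abbrev Word (d : ℕ) : Type := FreeMonoid (Fin d)

instance (d : ℕ) : DecidableEq (Word d) := inferInstanceAs (DecidableEq (List (Fin d)))

/-- The full Fock space over `ℂ^d`, realised as the square-summable sequences indexed by words. -/
abbrev Fock (d : ℕ) : Type := lp (fun _ : Word d => ℂ) 2

noncomputable section

variable {d : ℕ}

theorem memℓp_extend {g : Word d → Word d} (hg : Function.Injective g) (f : Fock d) :
    Memℓp (Function.extend g (f : Word d → ℂ) 0) 2 := by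
  have h := (memℓp_gen_iff (p := 2) (by simp)).1 (lp.memℓp f)
  refine (memℓp_gen_iff (p := 2) (by simp)).2 ?_
  refine (hg.summable_iff ?_).1 ?_
  · intro x hx
    rw [Function.extend_apply' _ _ _ (by simpa using hx)]
    simp
  · refine h.congr fun x => ?_
    simp [hg.extend_apply]

/-- The isometry of the Fock space sending the basis vector `e_α` to `e_{g α}`, for an injective
self-map `g` of the set of words. -/
def shift (g : Word d → Word d) (hg : Function.Injective g) : Fock d →ₗᵢ[ℂ] Fock d where
  toFun f := ⟨Function.extend g (f : Word d → ℂ) 0, memℓp_extend hg f⟩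
  map_add' f₁ f₂ := Subtype.ext <| by
    refine funext fun α => ?_
    change Function.extend g ((f₁ : Word d → ℂ) + (f₂ : Word d → ℂ)) (0 : Word d → ℂ) α =
      Function.extend g (f₁ : Word d → ℂ) (0 : Word d → ℂ) α +
        Function.extend g (f₂ : Word d → ℂ) (0 : Word d → ℂ) α
    by_cases h : ∃ β, g β = α
    · obtain ⟨β, rfl⟩ := h
      simp [hg.extend_apply]
    · simp [Function.extend_apply' _ _ _ h]
  map_smul' c f := Subtype.ext <| by
    refine funext fun α => ?_
    change Function.extend g (c • (f : Word d → ℂ)) (0 : Word d → ℂ) α =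
      c • Function.extend g (f : Word d → ℂ) (0 : Word d → ℂ) α
    by_cases h : ∃ β, g β = α
    · obtain ⟨β, rfl⟩ := h
      simp [hg.extend_apply]
    · simp [Function.extend_apply' _ _ _ h]
  norm_map' f := by
    rw [lp.norm_eq_tsum_rpow (by simp), lp.norm_eq_tsum_rpow (by simp)]
    congr 1
    refine (hg.tsum_eq ?_).symm.trans ?_
    · intro x hx
      by_contra h
      apply hx
      simp [Function.extend_apply' _ _ _ h]
    · simp [hg.extend_apply]

/-- The left free shift `L_k`, with `L_k e_α = e_{kα}`. -/
def leftShift (k : Fin d) : Fock d →L[ℂ] Fock d :=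
  (shift (fun α => FreeMonoid.of k * α)
    (fun _ _ h => mul_left_cancel h)).toContinuousLinearMap

/-- The free disk algebra: the norm closure of the unital algebra generated by `L_1, …, L_d`. -/
def freeDiskAlgebra (d : ℕ) : Subalgebra ℂ (Fock d →L[ℂ] Fock d) :=
  (Algebra.adjoin ℂ (Set.range (leftShift (d := d)))).topologicalClosure

/-- The free disk system: the norm closure of the sum of the free disk algebra and its adjoint. -/
def freeDiskSystem (d : ℕ) : Submodule ℂ (Fock d →L[ℂ] Fock d) :=
  (Subalgebra.toSubmodule (freeDiskAlgebra d) ⊔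
    Subalgebra.toSubmodule (star (freeDiskAlgebra d))).topologicalClosure

/-- Positive NC measures: positive linear functionals on the free disk system, whose order is the
Loewner order of operators on the Fock space. -/
abbrev NCMeasure (d : ℕ) : Type := freeDiskSystem d →ₚ[ℂ] ℂ

/-- The vacuum vector `1 = e_∅`. -/
def vacuum : Fock d := lp.single 2 (1 : Word d) (1 : ℂ)

/-- NC Lebesgue measure: the vacuum state `x ↦ ⟨1, x 1⟩`. -/
def lebesgue (d : ℕ) : NCMeasure d :=
  PositiveLinearMap.mk₀
    { toFun := fun x => inner ℂ (vacuum (d := d)) ((x : Fock d →L[ℂ] Fock d) vacuum)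
      map_add' := fun x y => by simp
      map_smul' := fun c x => by simp }
    (fun x hx => by
      have h : 0 ≤ (x : Fock d →L[ℂ] Fock d) := hx
      have := ((ContinuousLinearMap.nonneg_iff_isPositive _).1 h).inner_nonneg_right vacuum
      simpa using this)

theorem shift_apply_of_notMem (g : Word d → Word d) (hg : Function.Injective g) (f : Fock d)
    {α : Word d} (h : ¬∃ β, g β = α) : shift g hg f α = 0 :=
  Function.extend_apply' _ _ _ h

theorem shift_apply (g : Word d → Word d) (hg : Function.Injective g) (f : Fock d)
    (α : Word d) : shift g hg f (g α) = f α :=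
  hg.extend_apply _ _ _

theorem shift_single (g : Word d → Word d) (hg : Function.Injective g) (α : Word d) :
    shift g hg (lp.single 2 α (1 : ℂ)) = lp.single 2 (g α) (1 : ℂ) := by
  ext β
  by_cases h : ∃ γ, g γ = β
  · obtain ⟨γ, rfl⟩ := h
    rw [shift_apply]
    simp [Pi.single_apply, hg.eq_iff]
  · rw [shift_apply_of_notMem g hg _ h]
    have : β ≠ g α := fun h' => h ⟨α, h'.symm⟩
    simp [this]

/-- `L^α = L_{i₁} ⋯ L_{iₙ}` for the word `α = i₁ ⋯ iₙ`. -/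
def leftShiftWord : Word d →* (Fock d →L[ℂ] Fock d) := FreeMonoid.lift leftShift

theorem leftShift_mem (k : Fin d) :
    leftShift k ∈ Algebra.adjoin ℂ (Set.range (leftShift (d := d))) :=
  Algebra.subset_adjoin ⟨k, rfl⟩

theorem leftShiftWord_mem_adjoin (α : Word d) :
    leftShiftWord α ∈ Algebra.adjoin ℂ (Set.range (leftShift (d := d))) := by
  induction α using FreeMonoid.inductionOn' with
  | one => simp
  | of_mul k α ih =>
    rw [map_mul]
    exact mul_mem (by simpa [leftShiftWord] using leftShift_mem k) ih

theorem leftShiftWord_mem (α : Word d) : leftShiftWord α ∈ freeDiskAlgebra d :=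
  Subalgebra.le_topologicalClosure _ (leftShiftWord_mem_adjoin α)

theorem leftShiftWord_vacuum (α : Word d) :
    leftShiftWord α vacuum = lp.single 2 α (1 : ℂ) := by
  induction α using FreeMonoid.inductionOn' with
  | one => simp [vacuum]
  | of_mul k α ih =>
    rw [map_mul, mul_apply_eq_comp, ih]
    exact shift_single (fun α => FreeMonoid.of k * α) (fun _ _ h => mul_left_cancel h) α

theorem star_leftShift_mul (j k : Fin d) :
    star (leftShift j) * leftShift k = if j = k then 1 else 0 := by
  rw [ContinuousLinearMap.star_eq_adjoint]
  split_ifs with h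
  · subst h
    exact (ContinuousLinearMap.norm_map_iff_adjoint_comp_self _).1 (fun x => by simp [leftShift])
  · refine ContinuousLinearMap.ext fun x => ext_inner_left ℂ fun y => ?_
    rw [mul_apply_eq_comp, ContinuousLinearMap.adjoint_inner_right,
      lp.inner_eq_tsum]
    simp only [zero_apply, inner_zero_right]
    refine (tsum_congr fun α => ?_).trans tsum_zero
    by_cases h1 : ∃ β, FreeMonoid.of j * β = α
    · have h2 : leftShift k x α = 0 := by
        refine shift_apply_of_notMem (fun α => FreeMonoid.of k * α)
          (fun _ _ h => mul_left_cancel h) x ?_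
        rintro ⟨γ, hγ⟩
        obtain ⟨β, hβ⟩ := h1
        have := congrArg FreeMonoid.toList (hβ.trans hγ.symm)
        simp at this
        exact h this.1
      rw [h2, inner_zero_right]
    · have h2 : leftShift j y α = 0 := 
        shift_apply_of_notMem (fun α => FreeMonoid.of j * α) (fun _ _ h => mul_left_cancel h) y h1
      rw [h2, inner_zero_left]

/-- `(L^α)* L^β` is `(L^γ)*` if `α = βγ`, is `L^γ` if `β = αγ`, and is zero otherwise. -/
theorem leftShiftWord_star_mul (α β : Word d) :
    (∃ γ, α = β * γ ∧ star (leftShiftWord α) * leftShiftWord β = star (leftShiftWord γ)) ∨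
    (∃ γ, β = α * γ ∧ star (leftShiftWord α) * leftShiftWord β = leftShiftWord γ) ∨
    (star (leftShiftWord α) * leftShiftWord β = 0 ∧ (∀ γ, α ≠ β * γ) ∧ ∀ γ, β ≠ α * γ) := by
  induction α using FreeMonoid.inductionOn' generalizing β with
  | one => exact Or.inr (Or.inl ⟨β, by simp, by simp⟩)
  | of_mul j α ih =>
    induction β using FreeMonoid.inductionOn' with
    | one => exact Or.inl ⟨_, (one_mul _).symm, by simp⟩
    | of_mul k β _ =>
      have key : star (leftShiftWord (FreeMonoid.of j * α)) * leftShiftWord (FreeMonoid.of k * β)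
          = star (leftShiftWord α) * (star (leftShift j) * leftShift k) * leftShiftWord β := by
        simp [leftShiftWord, mul_assoc]
      rw [key, star_leftShift_mul]
      by_cases h : j = k
      · subst h
        simp only [if_true, mul_one, mul_assoc, ne_eq, mul_right_inj]
        exact ih β
      · refine Or.inr (Or.inr ⟨by simp [h], fun γ hγ => ?_, fun γ hγ => ?_⟩)
        · have := congrArg FreeMonoid.toList hγ
          simp at this
          exact h this.1
        · have := congrArg FreeMonoid.toList hγ
          simp at this
          exact h this.1.symm

theorem mem_system_of_mem {a : Fock d →L[ℂ] Fock d} (ha : a ∈ freeDiskAlgebra d) :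
    a ∈ freeDiskSystem d :=
  Submodule.le_topologicalClosure _ (Submodule.mem_sup_left ha)

theorem star_mem_system_of_mem {a : Fock d →L[ℂ] Fock d} (ha : a ∈ freeDiskAlgebra d) :
    star a ∈ freeDiskSystem d :=
  Submodule.le_topologicalClosure _ (Submodule.mem_sup_right
    (show star a ∈ star (freeDiskAlgebra d) from (Subalgebra.star_mem_star_iff _ _).2 ha))

theorem adjoin_le_span :
    (Subalgebra.toSubmodule (Algebra.adjoin ℂ (Set.range (leftShift (d := d))))) ≤
      Submodule.span ℂ (Set.range (leftShiftWord (d := d))) := by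
  rw [Algebra.adjoin_eq_span]
  refine Submodule.span_mono ?_
  intro x hx
  have : Submonoid.closure (Set.range (leftShift (d := d))) ≤
      MonoidHom.mrange (leftShiftWord (d := d)) := by
    rw [Submonoid.closure_le]
    rintro _ ⟨k, rfl⟩
    exact ⟨FreeMonoid.of k, by simp [leftShiftWord]⟩
  exact this hx

/-- The semi-Dirichlet property of the free disk algebra. -/
theorem star_mul_mem_system {a b : Fock d →L[ℂ] Fock d}
    (ha : a ∈ freeDiskAlgebra d) (hb : b ∈ freeDiskAlgebra d) :
    star a * b ∈ freeDiskSystem d := by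
  have hwords : ∀ α β : Word d,
      star (leftShiftWord α) * leftShiftWord β ∈ freeDiskSystem d := by
    intro α β
    rcases leftShiftWord_star_mul α β with ⟨γ, -, h⟩ | ⟨γ, -, h⟩ | ⟨h, -⟩
    · exact h ▸ star_mem_system_of_mem (leftShiftWord_mem γ)
    · exact h ▸ mem_system_of_mem (leftShiftWord_mem γ)
    · exact h ▸ zero_mem _
  have hword (α : Word d) : ∀ b ∈ Submodule.span ℂ (Set.range (leftShiftWord (d := d))),
      star (leftShiftWord α) * b ∈ freeDiskSystem d := by
    intro b hb
    induction hb using Submodule.span_induction with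
    | mem y hy => obtain ⟨β, rfl⟩ := hy; exact hwords α β
    | zero => simp
    | add y z _ _ h1 h2 => rw [mul_add]; exact add_mem h1 h2
    | smul c y _ h => rw [mul_smul_comm]; exact Submodule.smul_mem _ _ h
  have hspan : ∀ a ∈ Submodule.span ℂ (Set.range (leftShiftWord (d := d))),
      ∀ b ∈ Submodule.span ℂ (Set.range (leftShiftWord (d := d))),
      star a * b ∈ freeDiskSystem d := by
    intro a ha b hb
    induction ha using Submodule.span_induction with
    | mem x hx => obtain ⟨α, rfl⟩ := hx; exact hword α b hb
    | zero => simp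
    | add y z _ _ h1 h2 => rw [star_add, add_mul]; exact add_mem h1 h2
    | smul c y _ h =>
      rw [star_smul, smul_mul_assoc]; exact Submodule.smul_mem _ _ h
  have hcl : star a * b ∈ closure (freeDiskSystem d : Set (Fock d →L[ℂ] Fock d)) :=
    map_mem_closure₂ (f := fun a b => star a * b) (by fun_prop) ha hb
      (fun a ha b hb => hspan a (adjoin_le_span ha) b (adjoin_le_span hb))
  have hc : IsClosed (freeDiskSystem d : Set (Fock d →L[ℂ] Fock d)) :=
    Submodule.isClosed_topologicalClosure _
  rwa [hc.closure_eq] at hcl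

/-- The GNS pre-inner product `(a, b) ↦ μ(a* b)` on the free disk algebra. -/
def gnsForm (μ : NCMeasure d) :
    freeDiskAlgebra d →ₗ⋆[ℂ] freeDiskAlgebra d →ₗ[ℂ] ℂ :=
  LinearMap.mk₂'ₛₗ (starRingEnd ℂ) (RingHom.id ℂ)
    (fun a b => μ ⟨star (a : Fock d →L[ℂ] Fock d) * b, star_mul_mem_system a.2 b.2⟩)
    (fun a₁ a₂ b => by
      rw [← map_add]; congr 1; ext1; simp [add_mul])
    (fun c a b => by
      rw [← map_smul]; congr 1; ext1; simp)
    (fun a b₁ b₂ => by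
      rw [← map_add]; congr 1; ext1; simp [mul_add])
    (fun c a b => by
      rw [RingHom.id_apply, ← map_smul]; congr 1; ext1; simp)

theorem gnsForm_self_nonneg (μ : NCMeasure d) (a : freeDiskAlgebra d) :
    0 ≤ gnsForm μ a a := by
  have h : (0 : freeDiskSystem d) ≤
      ⟨star (a : Fock d →L[ℂ] Fock d) * a, star_mul_mem_system a.2 a.2⟩ := by
    change (0 : Fock d →L[ℂ] Fock d) ≤ star (a : Fock d →L[ℂ] Fock d) * a
    exact star_mul_self_nonneg _
  have hμ := OrderHomClass.mono μ h
  rwa [map_zero] at hμ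

/-- A densely defined positive semi-definite sesquilinear form in `H`, conjugate linear in its first
argument. -/
structure PosForm (H : Type*) [NormedAddCommGroup H] [InnerProductSpace ℂ H] where
  domain : Submodule ℂ H
  dense_domain : Dense (domain : Set H)
  form : domain →ₗ⋆[ℂ] domain →ₗ[ℂ] ℂ
  nonneg : ∀ x, 0 ≤ form x x

namespace PosForm
variable {H : Type*} [NormedAddCommGroup H] [InnerProductSpace ℂ H]

/-- The square of the norm `‖x‖_{q+1}`, that is, `q(x, x) + ‖x‖²`. -/
def normSqAddOne (q : PosForm H) (x : q.domain) : ℝ := (q.form x x).re + ‖x‖ ^ 2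

/-- The form is closed: its domain is complete in the norm `‖·‖_{q+1}`. -/
def IsClosed (q : PosForm H) : Prop :=
  ∀ x : ℕ → q.domain,
    (∀ ε > 0, ∃ N, ∀ m ≥ N, ∀ n ≥ N, q.normSqAddOne (x m - x n) < ε) →
    ∃ y : q.domain, Filter.Tendsto (fun n => q.normSqAddOne (x n - y)) Filter.atTop (nhds 0)

/-- The form `r` extends the form `q`. -/
structure Extends (r q : PosForm H) : Prop where
  le : q.domain ≤ r.domain
  eq : ∀ x y : q.domain, r.form (Submodule.inclusion le x) (Submodule.inclusion le y) = q.form x y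

/-- The form is closable: it has a closed extension. -/
def IsClosable (q : PosForm H) : Prop := ∃ r : PosForm H, r.Extends q ∧ r.IsClosed

end PosForm

theorem dense_span_single :
    Dense (Submodule.span ℂ (Set.range fun α : Word d => (lp.single 2 α (1 : ℂ) : Fock d)) :
      Set (Fock d)) := by
  intro f
  refine mem_closure_of_tendsto (lp.hasSum_single (p := 2) (by simp) f)
    (Filter.Eventually.of_forall fun s => ?_)
  refine Submodule.sum_mem _ fun α _ => ?_
  have : (lp.single 2 α (f α) : Fock d) = f α • lp.single 2 α (1 : ℂ) := by
    rw [← lp.single_smul]; simp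
  rw [this]
  exact Submodule.smul_mem _ _ (Submodule.subset_span ⟨α, rfl⟩)

/-- The identification `a ↦ a 1` of the free disk algebra with a subspace of the Fock space. -/
def symbol (d : ℕ) : freeDiskAlgebra d →ₗ[ℂ] Fock d :=
  (ContinuousLinearMap.apply ℂ (Fock d) (vacuum (d := d))).toLinearMap ∘ₗ
    (freeDiskAlgebra d).toSubmodule.subtype

theorem symbol_leftShiftWord (α : Word d) :
    symbol d ⟨leftShiftWord α, leftShiftWord_mem α⟩ = lp.single 2 α (1 : ℂ) :=
  leftShiftWord_vacuum α

theorem dense_range_symbol : Dense (LinearMap.range (symbol d) : Set (Fock d)) := by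
  refine dense_span_single.mono ?_
  refine Submodule.span_le.2 ?_
  rintro _ ⟨α, rfl⟩
  exact ⟨_, symbol_leftShiftWord α⟩

theorem shift_comm (g h : Word d → Word d) (hg : Function.Injective g)
    (hh : Function.Injective h) (hc : ∀ α, g (h α) = h (g α)) :
    (shift g hg).toContinuousLinearMap * (shift h hh).toContinuousLinearMap =
      (shift h hh).toContinuousLinearMap * (shift g hg).toContinuousLinearMap := by
  refine ContinuousLinearMap.ext_on dense_span_single ?_
  rintro _ ⟨α, rfl⟩
  simp [shift_single, hc]

theorem symbol_injective : Function.Injective (symbol d) := by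
  refine (injective_iff_map_eq_zero _).2 fun a ha => ?_
  have hr (α : Word d) : Function.Injective fun β : Word d => β * α :=
    fun _ _ h => mul_right_cancel h
  let ρ (α : Word d) : Fock d →L[ℂ] Fock d := (shift _ (hr α)).toContinuousLinearMap
  have hle : freeDiskAlgebra d ≤ Subalgebra.centralizer ℂ (Set.range ρ) := by
    refine Subalgebra.topologicalClosure_minimal ?_ (Set.isClosed_centralizer _)
    refine Algebra.adjoin_le ?_
    rintro _ ⟨k, rfl⟩
    rw [SetLike.mem_coe, Subalgebra.mem_centralizer_iff]
    rintro _ ⟨α, rfl⟩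
    exact shift_comm _ _ _ _ fun β => mul_assoc _ _ _
  have ha0 : (a : Fock d →L[ℂ] Fock d) vacuum = 0 := ha
  ext1
  refine ContinuousLinearMap.ext_on dense_span_single ?_
  rintro _ ⟨α, rfl⟩
  have h1 := (Subalgebra.mem_centralizer_iff ℂ).1 (hle a.2) (ρ α) ⟨α, rfl⟩
  have h2 : ρ α vacuum = lp.single 2 α (1 : ℂ) := by
    rw [← one_mul α]
    exact shift_single (fun β => β * (1 * α)) (hr (1 * α)) 1
  have h3 := DFunLike.congr_fun h1 (vacuum (d := d))
  simp only [mul_apply_eq_comp, h2, ha0, map_zero] at h3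
  simpa using h3.symm

/-- The free disk algebra is linearly isomorphic to its image in the Fock space. -/
def symbolEquiv (d : ℕ) : freeDiskAlgebra d ≃ₗ[ℂ] LinearMap.range (symbol d) :=
  LinearEquiv.ofInjective (symbol d) symbol_injective

/-- The sesquilinear form `(a 1, b 1) ↦ μ(a* b)`, for `a`, `b` in the free disk algebra. -/
def toeplitzSesq (μ : NCMeasure d) :
    LinearMap.range (symbol d) →ₗ⋆[ℂ] LinearMap.range (symbol d) →ₗ[ℂ] ℂ :=
  LinearMap.mk₂'ₛₗ (starRingEnd ℂ) (RingHom.id ℂ)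
    (fun x y => gnsForm μ ((symbolEquiv d).symm x) ((symbolEquiv d).symm y))
    (fun x₁ x₂ y => by simp) (fun c x y => by simp)
    (fun x y₁ y₂ => by simp) (fun c x y => by simp)

/-- The form `q_μ(a, b) = μ(a* b)`, whose domain is the free disk algebra inside the Fock space. -/
def toeplitzForm (μ : NCMeasure d) : PosForm (Fock d) where
  domain := LinearMap.range (symbol d)
  dense_domain := dense_range_symbol
  form := toeplitzSesq μ
  nonneg x := gnsForm_self_nonneg μ ((symbolEquiv d).symm x)

theorem toeplitzForm_symbol (μ : NCMeasure d) (a b : freeDiskAlgebra d) :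
    (toeplitzForm μ).form (symbolEquiv d a) (symbolEquiv d b) = gnsForm μ a b := by
  change gnsForm μ ((symbolEquiv d).symm (symbolEquiv d a))
    ((symbolEquiv d).symm (symbolEquiv d b)) = gnsForm μ a b
  simp

/-- An NC measure is absolutely continuous (with respect to NC Lebesgue measure) if its form `q_μ`
is closable. -/
def NCMeasure.IsAbsolutelyContinuous (μ : NCMeasure d) : Prop := (toeplitzForm μ).IsClosable

/-- Points of the NC open unit row-ball: `d`-tuples of `n × n` matrices, for some `n ≥ 1`, with
`Z_1 Z_1* + ⋯ + Z_d Z_d* < I`. -/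
structure NCBall (d : ℕ) where
  size : ℕ
  size_pos : 0 < size
  coord : Fin d → Matrix (Fin size) (Fin size) ℂ
  posDef : (1 - ∑ k, coord k * (coord k).conjTranspose).PosDef

/-- `Z^α = Z_{i₁} ⋯ Z_{iₙ}` for the word `α = i₁ ⋯ iₙ`. -/
def NCBall.word (Z : NCBall d) : Word d →* Matrix (Fin Z.size) (Fin Z.size) ℂ :=
  FreeMonoid.lift Z.coord

/-- Graded functions on the NC unit row-ball, taking `n × n` matrix values at level `n`. -/
abbrev NCFun (d : ℕ) : Type := (Z : NCBall d) → Matrix (Fin Z.size) (Fin Z.size) ℂ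

/-- The NC Hardy space: the functions `f(Z) = ∑ a_α Z^α` with square-summable coefficients. -/
def freeHardySpace (d : ℕ) : Set (NCFun d) :=
  {f | ∃ a : Fock d, ∀ Z : NCBall d, HasSum (fun α => a α • Z.word α) (f Z)}

/-- The NC Szegő kernel `K(Z, W)[P] = ∑ Z^α P (W^α)*`. -/
def szegoKernel (Z W : NCBall d) (P : Matrix (Fin Z.size) (Fin W.size) ℂ) :
    Matrix (Fin Z.size) (Fin W.size) ℂ :=
  ∑' α : Word d, Z.word α * P * (W.word α).conjTranspose

/-- The moment `μ(L^α)`. -/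
def moment (μ : NCMeasure d) (α : Word d) : ℂ :=
  μ ⟨leftShiftWord α, mem_system_of_mem (leftShiftWord_mem α)⟩

/-- The Taylor coefficients at `0` of the right NC Herglotz transform of `μ`: `μ(I)` at the empty
word, and twice the conjugate of `μ(L^α)` at every other word. -/
def herglotzCoeff (μ : NCMeasure d) (α : Word d) : ℂ :=
  if α = 1 then moment μ 1 else 2 * star (moment μ α)

/-- The right NC Herglotz transform `H_μ(Z) = μ(I) I + 2 ∑_{α ≠ ∅} conj(μ(L^α)) Z^α`. -/
def herglotzTransform (μ : NCMeasure d) : NCFun d :=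
  fun Z => ∑' α : Word d, herglotzCoeff μ α • Z.word α

/-- The right free Herglotz kernel `K^μ(Z, W)[P] = ½ K(Z, W)[H_μ(Z) P + P H_μ(W)*]`, where `K` is
the NC Szegő kernel. -/
def herglotzKernel (μ : NCMeasure d) (Z W : NCBall d) (P : Matrix (Fin Z.size) (Fin W.size) ℂ) :
    Matrix (Fin Z.size) (Fin W.size) ℂ :=
  (1 / 2 : ℂ) • szegoKernel Z W
    (herglotzTransform μ Z * P + P * (herglotzTransform μ W).conjTranspose)

/-- The squared Euclidean norm. -/
def normSq {n : ℕ} (x : Fin n → ℂ) : ℝ := ∑ i, ‖x i‖ ^ 2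

theorem normSq_eq {n : ℕ} (x : Fin n → ℂ) : normSq x = (star x ⬝ᵥ x).re := by
  simp [normSq, dotProduct, ← Complex.normSq_eq_norm_sq, Complex.normSq_apply]

theorem NCBall.exists_ratio (Z : NCBall d) : ∃ r : ℝ, 0 < r ∧ r < 1 ∧
    ∀ x : Fin Z.size → ℂ,
      ∑ k, normSq ((Z.coord k).conjTranspose.mulVec x) ≤ r * normSq x := by
  set P := 1 - ∑ k, Z.coord k * (Z.coord k).conjTranspose with hP
  have hQ (x : Fin Z.size → ℂ) : (star x ⬝ᵥ P.mulVec x).re =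
      normSq x - ∑ k, normSq ((Z.coord k).conjTranspose.mulVec x) := by
    rw [hP, Matrix.sub_mulVec, dotProduct_sub, Complex.sub_re, Matrix.one_mulVec, ← normSq_eq,
      Matrix.sum_mulVec, dotProduct_sum, Complex.re_sum]
    congr 1
    refine Finset.sum_congr rfl fun k _ => ?_
    rw [normSq_eq, Matrix.star_mulVec, Matrix.conjTranspose_conjTranspose,
      ← Matrix.mulVec_mulVec, Matrix.dotProduct_mulVec]
  have hne : (Metric.sphere (0 : Fin Z.size → ℂ) 1).Nonempty := by
    have : Nonempty (Fin Z.size) := ⟨⟨0, Z.size_pos⟩⟩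
    exact NormedSpace.sphere_nonempty.2 zero_le_one
  obtain ⟨x₀, hx₀, hmin⟩ := (isCompact_sphere (0 : Fin Z.size → ℂ) 1).exists_isMinOn hne
    (f := fun x => (star x ⬝ᵥ P.mulVec x).re) (by fun_prop)
  set c := (star x₀ ⬝ᵥ P.mulVec x₀).re with hc
  have hx0 : x₀ ≠ 0 := by
    rintro rfl
    simp at hx₀
  have hcpos : 0 < c := Z.posDef.re_dotProduct_pos hx0
  have hn : (0 : ℝ) < Z.size := by exact_mod_cast Z.size_pos
  have hlow (x : Fin Z.size → ℂ) : c * ‖x‖ ^ 2 ≤ (star x ⬝ᵥ P.mulVec x).re := by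
    by_cases hx : x = 0
    · simp [hx]
    · have hxn : 0 < ‖x‖ := norm_pos_iff.2 hx
      have h1 : ((‖x‖⁻¹ : ℝ) : ℂ) • x ∈ Metric.sphere (0 : Fin Z.size → ℂ) 1 := by
        simp [norm_smul, hxn.ne']
      have h2 := hmin h1
      simp only [Set.mem_ofPred_eq] at h2
      rw [Matrix.mulVec_smul, star_smul, smul_dotProduct, dotProduct_smul] at h2
      simp only [smul_eq_mul, Complex.star_def, Complex.conj_ofReal, ← mul_assoc,
        ← Complex.ofReal_mul, Complex.re_ofReal_mul] at h2
      rw [← hc] at h2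
      calc c * ‖x‖ ^ 2 ≤ (‖x‖⁻¹ * ‖x‖⁻¹ * (star x ⬝ᵥ P.mulVec x).re) * ‖x‖ ^ 2 := by gcongr
        _ = _ := by field_simp
  have hsup (x : Fin Z.size → ℂ) : normSq x ≤ Z.size * ‖x‖ ^ 2 := by
    calc normSq x ≤ ∑ _i : Fin Z.size, ‖x‖ ^ 2 := by
          refine Finset.sum_le_sum fun i _ => ?_
          have := norm_le_pi_norm x i
          gcongr
      _ = _ := by simp
  refine ⟨max (1 - c / Z.size) (1 / 2), by positivity, ?_, fun x => ?_⟩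
  · rw [max_lt_iff]
    have : 0 < c / Z.size := by positivity
    constructor <;> linarith
  · have hx : 0 ≤ normSq x := Finset.sum_nonneg fun i _ => by positivity
    have h3 : c / Z.size * normSq x ≤ c * ‖x‖ ^ 2 := by
      calc c / Z.size * normSq x ≤ c / Z.size * (Z.size * ‖x‖ ^ 2) := by gcongr; exact hsup x
        _ = _ := by field_simp
    have h4 := hlow x
    rw [hQ x] at h4
    calc _ ≤ (1 - c / Z.size) * normSq x := by linarith
      _ ≤ _ := by gcongr; exact le_max_left _ _

/-- The word `w 0 w 1 ⋯ w (n-1)`. -/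
def tupleWord {n : ℕ} (w : Fin n → Fin d) : Word d := FreeMonoid.ofList (List.ofFn w)

theorem tupleWord_cons {n : ℕ} (k : Fin d) (w : Fin n → Fin d) :
    tupleWord (Fin.cons k w : Fin (n + 1) → Fin d) = FreeMonoid.of k * tupleWord w := by
  simp only [tupleWord, List.ofFn_cons]
  rfl

theorem tupleWord_injective {n : ℕ} :
    Function.Injective (tupleWord : (Fin n → Fin d) → Word d) :=
  List.ofFn_injective

theorem summable_of_level {f : Word d → ℝ} (hf : ∀ α, 0 ≤ f α) {C ρ : ℝ} (h0 : 0 ≤ ρ) (h1 : ρ < 1)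
    (hle : ∀ n, ∑ w : Fin n → Fin d, f (tupleWord w) ≤ C * ρ ^ n) : Summable f := by
  have key : Summable fun p : (Σ n, Fin n → Fin d) => f (tupleWord p.2) := by
    refine (summable_sigma_of_nonneg fun p => hf _).2 ⟨fun n => Summable.of_finite, ?_⟩
    refine Summable.of_nonneg_of_le (fun n => tsum_nonneg fun w => hf _) (fun n => ?_)
      ((summable_geometric_of_lt_one h0 h1).mul_left C)
    rw [tsum_fintype]
    exact hle n
  exact ((List.equivSigmaTuple (α := Fin d)).symm.summable_iff (f := f)).1 key

theorem NCBall.sum_level_le (Z : NCBall d) {r : ℝ} (hr : 0 ≤ r)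
    (h : ∀ x : Fin Z.size → ℂ,
      ∑ k, normSq ((Z.coord k).conjTranspose.mulVec x) ≤ r * normSq x) (n : ℕ)
    (x : Fin Z.size → ℂ) :
    ∑ w : Fin n → Fin d, normSq ((Z.word (tupleWord w)).conjTranspose.mulVec x)
      ≤ r ^ n * normSq x := by
  induction n generalizing x with
  | zero => simp [tupleWord]
  | succ n ih =>
    rw [← (Fin.consEquiv fun _ => Fin d).sum_comp, Fintype.sum_prod_type]
    calc _ = ∑ k, ∑ w : Fin n → Fin d, normSq ((Z.word (tupleWord w)).conjTranspose.mulVec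
              ((Z.coord k).conjTranspose.mulVec x)) := by
          refine Finset.sum_congr rfl fun k _ => Finset.sum_congr rfl fun w _ => ?_
          rw [Matrix.mulVec_mulVec, ← Matrix.conjTranspose_mul]
          congr 3
          change Z.word (tupleWord (Fin.cons k w : Fin (n + 1) → Fin d)) = _
          rw [tupleWord_cons, map_mul]
          simp [NCBall.word]
      _ ≤ ∑ k, r ^ n * normSq ((Z.coord k).conjTranspose.mulVec x) :=
          Finset.sum_le_sum fun k _ => ih _
      _ = r ^ n * ∑ k, normSq ((Z.coord k).conjTranspose.mulVec x) := by rw [Finset.mul_sum]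
      _ ≤ r ^ n * (r * normSq x) := by gcongr; exact h x
      _ = _ := by ring

theorem NCBall.sum_entry_le (Z : NCBall d) {r : ℝ} (hr : 0 ≤ r)
    (h : ∀ x : Fin Z.size → ℂ,
      ∑ k, normSq ((Z.coord k).conjTranspose.mulVec x) ≤ r * normSq x) (n : ℕ)
    (i j : Fin Z.size) :
    ∑ w : Fin n → Fin d, ‖Z.word (tupleWord w) i j‖ ^ 2 ≤ r ^ n := by
  refine le_trans (Finset.sum_le_sum fun w _ => ?_)
    ((Z.sum_level_le hr h n (Pi.single i 1)).trans_eq ?_)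
  · refine le_trans ?_ (Finset.single_le_sum (f := fun l => ‖(Matrix.mulVec
      (Z.word (tupleWord w)).conjTranspose (Pi.single i 1)) l‖ ^ 2)
      (fun _ _ => by positivity) (Finset.mem_univ j))
    simp
  · simp [normSq, Pi.single_apply, apply_ite]

theorem NCBall.summable_entry_sq (Z : NCBall d) (i j : Fin Z.size) :
    Summable fun α => ‖Z.word α i j‖ ^ 2 := by
  obtain ⟨r, h0, h1, h⟩ := Z.exists_ratio
  refine summable_of_level (C := 1) (fun α => by positivity) h0.le h1 fun n => ?_
  simpa using Z.sum_entry_le h0.le h n i j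

theorem gnsForm_conj (μ : NCMeasure d) (a b : freeDiskAlgebra d) :
    star (gnsForm μ a b) = gnsForm μ b a := by
  have ha := (Complex.nonneg_iff.1 (gnsForm_self_nonneg μ a)).2
  have hb := (Complex.nonneg_iff.1 (gnsForm_self_nonneg μ b)).2
  have h1 := (Complex.nonneg_iff.1 (gnsForm_self_nonneg μ (a + b))).2
  have h2 := (Complex.nonneg_iff.1 (gnsForm_self_nonneg μ (a + Complex.I • b))).2
  simp only [map_add, LinearMap.add_apply, LinearMap.map_smulₛₗ, LinearMap.smul_apply, map_smul,
    Complex.add_im, smul_eq_mul, Complex.conj_I, Complex.mul_im, Complex.I_re, Complex.I_im,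
    Complex.neg_re, Complex.neg_im, Complex.mul_re, Complex.add_re] at h1 h2
  apply Complex.ext
  · simp only [Complex.star_def, Complex.conj_re]; linarith
  · simp only [Complex.star_def, Complex.conj_im]; linarith

theorem gnsForm_one_left (μ : NCMeasure d) (β : Word d) :
    gnsForm μ 1 ⟨_, leftShiftWord_mem β⟩ = moment μ β := by
  simp [gnsForm, moment]

/-- `L^α` as an element of the free disk algebra. -/
def wordElt (α : Word d) : freeDiskAlgebra d := ⟨leftShiftWord α, leftShiftWord_mem α⟩

theorem wordElt_one : wordElt (1 : Word d) = 1 := by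
  ext1; simp [wordElt]

theorem gnsForm_one_wordElt (μ : NCMeasure d) (β : Word d) :
    gnsForm μ 1 (wordElt β) = moment μ β := gnsForm_one_left μ β

theorem gnsForm_congr (μ : NCMeasure d) {a b a' b' : freeDiskAlgebra d}
    (h : star (a : Fock d →L[ℂ] Fock d) * b = star (a' : Fock d →L[ℂ] Fock d) * b') :
    gnsForm μ a b = gnsForm μ a' b' := by
  simp [gnsForm, h]

theorem gnsForm_wordElt (μ : NCMeasure d) (α β : Word d) :
    (∃ γ, α = β * γ ∧ gnsForm μ (wordElt α) (wordElt β) = star (moment μ γ)) ∨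
    (∃ γ, β = α * γ ∧ gnsForm μ (wordElt α) (wordElt β) = moment μ γ) ∨
    (gnsForm μ (wordElt α) (wordElt β) = 0 ∧ (∀ γ, α ≠ β * γ) ∧ ∀ γ, β ≠ α * γ) := by
  rcases leftShiftWord_star_mul α β with ⟨γ, h1, h⟩ | ⟨γ, h1, h⟩ | ⟨h, h1⟩
  · refine Or.inl ⟨γ, h1, ?_⟩
    rw [← gnsForm_one_wordElt, gnsForm_conj]
    exact gnsForm_congr μ (by simpa [wordElt] using h)
  · refine Or.inr (Or.inl ⟨γ, h1, ?_⟩)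
    rw [← gnsForm_one_wordElt]
    exact gnsForm_congr μ (by simpa [wordElt] using h)
  · refine Or.inr (Or.inr ⟨?_, h1⟩)
    rw [gnsForm_congr μ (a' := 0) (b' := 0) (by simpa [wordElt] using h)]
    simp

theorem moment_one_nonneg (μ : NCMeasure d) : 0 ≤ moment μ 1 := by
  rw [← gnsForm_one_wordElt, wordElt_one]
  exact gnsForm_self_nonneg μ 1

theorem star_moment_one (μ : NCMeasure d) : star (moment μ 1) = moment μ 1 := by
  rw [← gnsForm_one_wordElt, wordElt_one, gnsForm_conj]

theorem moment_one_ofReal (μ : NCMeasure d) : (((moment μ 1).re : ℝ) : ℂ) = moment μ 1 :=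
  Complex.conj_eq_iff_re.1 (star_moment_one μ)

theorem length_tupleWord {n : ℕ} (w : Fin n → Fin d) : (tupleWord w).length = n := by
  simp [tupleWord, FreeMonoid.length]

theorem gnsForm_tupleWord (μ : NCMeasure d) {n : ℕ} (v w : Fin n → Fin d) :
    gnsForm μ (wordElt (tupleWord v)) (wordElt (tupleWord w)) =
      if v = w then moment μ 1 else 0 := by
  have hlen : ∀ {v w : Fin n → Fin d} {γ : Word d}, tupleWord v = tupleWord w * γ →
      γ = 1 := by
    intro v w γ h
    have h' := congrArg FreeMonoid.length h
    rw [FreeMonoid.length_mul, length_tupleWord, length_tupleWord] at h'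
    exact FreeMonoid.length_eq_zero.1 (by omega)
  rcases gnsForm_wordElt μ (tupleWord v) (tupleWord w) with ⟨γ, h1, h⟩ | ⟨γ, h1, h⟩ | ⟨h, h1, -⟩
  · obtain rfl := hlen h1
    rw [mul_one] at h1
    rw [h, star_moment_one, if_pos (tupleWord_injective h1)]
  · obtain rfl := hlen h1
    rw [mul_one] at h1
    rw [h, if_pos (tupleWord_injective h1.symm)]
  · rw [h, if_neg]
    rintro rfl
    exact h1 1 (mul_one _).symm

theorem sum_moment_sq_le (μ : NCMeasure d) (n : ℕ) :
    ∑ w : Fin n → Fin d, ‖moment μ (tupleWord w)‖ ^ 2 ≤ (moment μ 1).re ^ 2 := by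
  set S := ∑ w : Fin n → Fin d, ‖moment μ (tupleWord w)‖ ^ 2 with hS
  set a : freeDiskAlgebra d :=
    ∑ w : Fin n → Fin d, star (moment μ (tupleWord w)) • wordElt (tupleWord w) with ha
  have hSc : (S : ℂ) = ∑ w : Fin n → Fin d,
      star (moment μ (tupleWord w)) * moment μ (tupleWord w) := by
    rw [hS]; push_cast
    refine Finset.sum_congr rfl fun w _ => ?_
    rw [Complex.star_def, mul_comm, Complex.mul_conj, Complex.normSq_eq_norm_sq]; norm_cast
  have h1a : gnsForm μ 1 a = S := by
    rw [ha, map_sum, hSc]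
    refine Finset.sum_congr rfl fun w _ => ?_
    rw [map_smul, gnsForm_one_wordElt, smul_eq_mul]
  have ha1 : gnsForm μ a 1 = S := by
    rw [← gnsForm_conj, h1a]; simp
  have haa : gnsForm μ a a = S * moment μ 1 := by
    have hw (w : Fin n → Fin d) : gnsForm μ (wordElt (tupleWord w)) a =
        star (moment μ (tupleWord w)) * moment μ 1 := by
      rw [ha, map_sum, Finset.sum_eq_single w]
      · simp [gnsForm_tupleWord]
      · intro v _ hv
        simp [gnsForm_tupleWord, hv.symm]
      · simp
    conv_lhs => enter [2]; rw [ha]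
    rw [map_sum, hSc, Finset.sum_mul]
    refine Finset.sum_congr rfl fun v _ => ?_
    rw [map_smul, ← gnsForm_conj, hw, star_mul, star_moment_one, star_star, smul_eq_mul]
    ring
  have h11 : gnsForm μ 1 1 = moment μ 1 := by
    rw [← gnsForm_one_wordElt, wordElt_one]
  have hm : 0 ≤ (moment μ 1).re := (Complex.nonneg_iff.1 (moment_one_nonneg μ)).1
  have key (c : ℝ) : 0 ≤ S * (moment μ 1).re - 2 * c * S + c ^ 2 * (moment μ 1).re := by
    have h := (Complex.nonneg_iff.1 (gnsForm_self_nonneg μ (a - (c : ℂ) • 1))).1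
    have e : gnsForm μ (a - (c : ℂ) • 1) (a - (c : ℂ) • 1) =
        ((S * (moment μ 1).re - 2 * c * S + c ^ 2 * (moment μ 1).re : ℝ) : ℂ) := by
      simp only [map_sub, LinearMap.sub_apply, LinearMap.map_smulₛₗ, LinearMap.smul_apply, map_smul,
        h1a, ha1, haa, h11, smul_eq_mul, Complex.conj_ofReal]
      push_cast
      rw [moment_one_ofReal]
      ring
    rwa [e, Complex.ofReal_re] at h
  rcases hm.eq_or_lt with h0 | hpos
  · have := key 1
    rw [← h0] at this ⊢
    nlinarith
  · have := key (moment μ 1).re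
    nlinarith

theorem norm_herglotzCoeff_le (μ : NCMeasure d) (α : Word d) :
    ‖herglotzCoeff μ α‖ ≤ 2 * ‖moment μ α‖ := by
  unfold herglotzCoeff
  split_ifs with h
  · subst h
    linarith [norm_nonneg (moment μ 1)]
  · simp

theorem summable_entry_mul_coeff (μ : NCMeasure d) (Z : NCBall d) (i j : Fin Z.size) :
    Summable fun α => ‖herglotzCoeff μ α * Z.word α i j‖ := by
  obtain ⟨r, h0, h1, h⟩ := Z.exists_ratio
  set t := √r with ht
  have ht0 : 0 < t := Real.sqrt_pos.2 h0
  have ht1 : t < 1 := by rw [ht, Real.sqrt_lt' one_pos]; simpa using h1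
  have htt : t * t = r := Real.mul_self_sqrt h0.le
  have hA : Summable fun α : Word d => ‖Z.word α i j‖ ^ 2 * (t⁻¹) ^ α.length := by
    refine summable_of_level (C := 1) (fun α => by positivity) ht0.le ht1 fun n => ?_
    simp only [length_tupleWord, ← Finset.sum_mul]
    calc _ ≤ r ^ n * (t⁻¹) ^ n := by gcongr; exact Z.sum_entry_le h0.le h n i j
      _ = 1 * t ^ n := by rw [← htt, ← mul_pow, one_mul]; congr 1; field_simp
  have hB : Summable fun α : Word d => ‖moment μ α‖ ^ 2 * t ^ α.length := by
    refine summable_of_level (C := (moment μ 1).re ^ 2) (fun α => by positivity) ht0.le ht1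
      fun n => ?_
    simp only [length_tupleWord, ← Finset.sum_mul]
    gcongr
    exact sum_moment_sq_le μ n
  refine Summable.of_nonneg_of_le (fun α => norm_nonneg _) (fun α => ?_) (hA.add hB)
  rw [norm_mul]
  have hs : 0 < √(t ^ α.length) := Real.sqrt_pos.2 (by positivity)
  have e : √(t ^ α.length) * √(t ^ α.length) = t ^ α.length := Real.mul_self_sqrt (by positivity)
  calc ‖herglotzCoeff μ α‖ * ‖Z.word α i j‖ ≤ 2 * ‖moment μ α‖ * ‖Z.word α i j‖ := by
        gcongr; exact norm_herglotzCoeff_le μ α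
    _ = 2 * (‖Z.word α i j‖ * (√(t ^ α.length))⁻¹) * (‖moment μ α‖ * √(t ^ α.length)) := by
        field_simp
    _ ≤ (‖Z.word α i j‖ * (√(t ^ α.length))⁻¹) ^ 2 + (‖moment μ α‖ * √(t ^ α.length)) ^ 2 :=
        two_mul_le_add_sq _ _
    _ = _ := by
        rw [mul_pow, mul_pow, inv_pow, inv_pow, sq (√(t ^ α.length)), e]

/-- A point `Z` of the ball together with a position `(i, j)` in the matrices of its level. A graded
function `f` on the ball is the same as the scalar function `(Z, i, j) ↦ f(Z)_{ij}`. -/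
abbrev Entry (d : ℕ) : Type := Σ Z : NCBall d, Fin Z.size × Fin Z.size

/-- The `(i, j)` entry of `Z^α`. -/
def Entry.mon (p : Entry d) (α : Word d) : ℂ := p.1.word α p.2.1 p.2.2

theorem summable_mon_mul (p q : Entry d) : Summable fun α => ‖p.mon α * star (q.mon α)‖ := by
  refine Summable.of_nonneg_of_le (fun α => norm_nonneg _) (fun α => ?_)
    ((p.1.summable_entry_sq p.2.1 p.2.2).add (q.1.summable_entry_sq q.2.1 q.2.2))
  rw [norm_mul, norm_star]
  have := two_mul_le_add_sq ‖p.mon α‖ ‖q.mon α‖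
  have h2 : 0 ≤ ‖p.mon α‖ * ‖q.mon α‖ := by positivity
  simp only [Entry.mon] at *
  linarith

/-- The sum `∑ (Z^α)_{ij} conj((W^α)_{kl})`. -/
def szegoEntry (p q : Entry d) : ℂ := ∑' α, p.mon α * star (q.mon α)

theorem szegoKernel_apply (Z W : NCBall d) (P : Matrix (Fin Z.size) (Fin W.size) ℂ)
    (i : Fin Z.size) (k : Fin W.size) :
    szegoKernel Z W P i k = ∑ a, ∑ b, P a b * szegoEntry ⟨Z, i, a⟩ ⟨W, k, b⟩ := by
  have h : HasSum (fun α : Word d => Z.word α * P * (W.word α).conjTranspose)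
      (Matrix.of fun i k => ∑ a, ∑ b, P a b * szegoEntry ⟨Z, i, a⟩ ⟨W, k, b⟩) := by
    refine Pi.hasSum.2 fun i => Pi.hasSum.2 fun k => ?_
    have h1 : HasSum (fun α : Word d => ∑ a, ∑ b,
        P a b * (Entry.mon ⟨Z, i, a⟩ α * star (Entry.mon ⟨W, k, b⟩ α)))
        (∑ a, ∑ b, P a b * szegoEntry ⟨Z, i, a⟩ ⟨W, k, b⟩) :=
      hasSum_sum fun a _ => hasSum_sum fun b _ =>
        ((summable_mon_mul _ _).of_norm.hasSum).mul_left _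
    rw [Matrix.of_apply]
    convert! h1 using 2 with α
    simp only [Entry.mon, Matrix.mul_apply, Matrix.conjTranspose_apply, Finset.sum_mul]
    rw [Finset.sum_comm]
    exact Finset.sum_congr rfl fun a _ => Finset.sum_congr rfl fun b _ => by ring
  rw [szegoKernel, h.tsum_eq]
  rfl

theorem herglotzTransform_apply (μ : NCMeasure d) (Z : NCBall d) (i j : Fin Z.size) :
    herglotzTransform μ Z i j = ∑' α, herglotzCoeff μ α * Z.word α i j := by
  have h : HasSum (fun α : Word d => herglotzCoeff μ α • Z.word α)
      (Matrix.of fun i j => ∑' α, herglotzCoeff μ α * Z.word α i j) := by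
    refine Pi.hasSum.2 fun i => Pi.hasSum.2 fun j => ?_
    exact (summable_entry_mul_coeff μ Z i j).of_norm.hasSum
  rw [herglotzTransform, h.tsum_eq]
  rfl

/-- The `(i, k)` entry of `K(Z, W)[H_μ(Z) E_{jl}]`. -/
def herglotzHalf (μ : NCMeasure d) (p q : Entry d) : ℂ :=
  ∑ a, herglotzTransform μ p.1 a p.2.2 * szegoEntry ⟨p.1, p.2.1, a⟩ q

theorem szegoEntry_star (p q : Entry d) : star (szegoEntry p q) = szegoEntry q p := by
  rw [szegoEntry, tsum_star]
  exact tsum_congr fun α => by simp [mul_comm]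

/-- The `(i, k)` entry of `K^μ(Z, W)[E_{jl}]`. -/
def herglotzEntry (μ : NCMeasure d) (p q : Entry d) : ℂ :=
  herglotzKernel μ p.1 q.1 (Matrix.single p.2.2 q.2.2 1) p.2.1 q.2.1

theorem herglotzEntry_eq (μ : NCMeasure d) (p q : Entry d) :
    herglotzEntry μ p q = 1 / 2 * (herglotzHalf μ p q + star (herglotzHalf μ q p)) := by
  obtain ⟨Z, i, j⟩ := p
  obtain ⟨W, k, l⟩ := q
  simp only [herglotzEntry, herglotzKernel, Matrix.smul_apply, smul_eq_mul, szegoKernel_apply,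
    Matrix.add_apply, add_mul, Finset.sum_add_distrib, herglotzHalf, star_sum, star_mul',
    szegoEntry_star]
  congr 2
  · refine Finset.sum_congr rfl fun a _ => ?_
    rw [Finset.sum_eq_single l]
    · simp
    · intro b _ hb
      simp [Matrix.mul_single_apply_of_ne _ _ _ _ _ hb]
    · simp
  · rw [Finset.sum_comm]
    refine Finset.sum_congr rfl fun b _ => ?_
    rw [Finset.sum_eq_single j]
    · simp
    · intro a _ ha
      simp [Matrix.single_mul_apply_of_ne _ _ _ _ _ ha]
    · simp

/-- `(γ, δ) ↦ (γδ, γ)`. -/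
def prefixPair (x : Word d × Word d) : Word d × Word d := (x.1 * x.2, x.1)

theorem prefixPair_injective : Function.Injective (prefixPair (d := d)) := by
  rintro ⟨a, b⟩ ⟨a', b'⟩ h
  simp only [prefixPair, Prod.mk.injEq] at h
  obtain ⟨h1, rfl⟩ := h
  simpa using h1

/-- The function with value `herglotzCoeff μ δ` at `(γδ, γ)` and zero at all other pairs. -/
def coeffExt (μ : NCMeasure d) : Word d × Word d → ℂ :=
  Function.extend prefixPair (fun x => herglotzCoeff μ x.2) 0

theorem gnsForm_wordElt_eq (μ : NCMeasure d) (α β : Word d) :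
    gnsForm μ (wordElt α) (wordElt β) =
      1 / 2 * (coeffExt μ (α, β) + star (coeffExt μ (β, α))) := by
  have hext (α γ : Word d) : coeffExt μ (α * γ, α) = herglotzCoeff μ γ :=
    prefixPair_injective.extend_apply _ _ (α, γ)
  have hzero (α β : Word d) (h : ∀ γ, α ≠ β * γ) : coeffExt μ (α, β) = 0 := by
    refine Function.extend_apply' _ _ _ ?_
    rintro ⟨⟨γ, δ⟩, hx⟩
    simp only [prefixPair, Prod.mk.injEq] at hx
    obtain ⟨h1, rfl⟩ := hx
    exact h δ h1.symm
  have hne (α γ : Word d) (h : γ ≠ 1) : ∀ δ, α ≠ α * γ * δ := by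
    intro δ hδ
    have h' := congrArg FreeMonoid.length hδ
    rw [FreeMonoid.length_mul, FreeMonoid.length_mul] at h'
    exact h (FreeMonoid.length_eq_zero.1 (by omega))
  rcases gnsForm_wordElt μ α β with ⟨γ, rfl, h⟩ | ⟨γ, rfl, h⟩ | ⟨h, h1, h2⟩
  · rw [h, hext]
    by_cases hγ : γ = 1
    · subst hγ
      have := hext β 1
      rw [mul_one] at this ⊢
      simp [this, herglotzCoeff, star_moment_one]
      ring
    · rw [hzero _ _ (hne β γ hγ)]
      simp [herglotzCoeff, hγ]
  · rw [h, hext]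
    by_cases hγ : γ = 1
    · subst hγ
      have := hext α 1
      rw [mul_one] at this ⊢
      simp [this, herglotzCoeff, star_moment_one]
      ring
    · rw [hzero _ _ (hne α γ hγ)]
      simp [herglotzCoeff, hγ]
  · rw [h, hzero _ _ h1, hzero _ _ h2]
    simp

theorem hasSum_herglotzHalf (μ : NCMeasure d) (p q : Entry d) :
    HasSum (fun x : Word d × Word d => p.mon x.1 * star (q.mon x.2) * coeffExt μ x)
      (herglotzHalf μ p q) := by
  refine (prefixPair_injective.hasSum_iff ?_).1 ?_
  · intro x hx
    have : coeffExt μ x = 0 := Function.extend_apply' _ _ _ hx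
    rw [this, mul_zero]
  · have h1 (a : Fin p.1.size) : HasSum (fun x : Word d × Word d =>
        (Entry.mon ⟨p.1, p.2.1, a⟩ x.1 * star (q.mon x.1)) *
          (herglotzCoeff μ x.2 * p.1.word x.2 a p.2.2))
        (herglotzTransform μ p.1 a p.2.2 * szegoEntry ⟨p.1, p.2.1, a⟩ q) := by
      have hs1 := summable_mon_mul ⟨p.1, p.2.1, a⟩ q
      have hs2 := summable_entry_mul_coeff μ p.1 a p.2.2
      have := (summable_mul_of_summable_norm hs1 hs2).hasSum
      rwa [← tsum_mul_tsum_of_summable_norm hs1 hs2, ← herglotzTransform_apply, mul_comm] at this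
    have h2 := hasSum_sum fun a (_ : a ∈ Finset.univ) => h1 a
    rw [herglotzHalf]
    convert! h2 using 2 with x
    have : coeffExt μ (prefixPair x) = herglotzCoeff μ x.2 :=
      prefixPair_injective.extend_apply _ _ x
    simp only [Function.comp_apply, this]
    simp only [prefixPair, Entry.mon, map_mul, Matrix.mul_apply, Finset.sum_mul]
    exact Finset.sum_congr rfl fun a _ => by ring

theorem hasSum_herglotzEntry (μ : NCMeasure d) (p q : Entry d) :
    HasSum (fun x : Word d × Word d => p.mon x.1 * star (q.mon x.2) *
      gnsForm μ (wordElt x.1) (wordElt x.2)) (herglotzEntry μ p q) := by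
  have h1 := hasSum_herglotzHalf μ p q
  have h2 := ((Equiv.prodComm _ _).hasSum_iff.2 (hasSum_herglotzHalf μ q p)).star
  rw [herglotzEntry_eq]
  convert! (h1.add h2).mul_left (1 / 2 : ℂ) using 2 with x
  obtain ⟨α, β⟩ := x
  rw [gnsForm_wordElt_eq]
  simp
  ring

/-- The scalar kernel of an NC kernel `K` on positions `(Z, i, j)`: its value at `(Z, i, j)` and
`(W, k, l)` is the inner product of the kernel vectors `K{Z, e_i, e_j}` and `K{W, e_k, e_l}`, namely
`e_i* K(Z, W)[e_j e_l*] e_k`. -/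
def kernelMatrix (K : ∀ Z W : NCBall d, Matrix (Fin Z.size) (Fin W.size) ℂ →
    Matrix (Fin Z.size) (Fin W.size) ℂ) : Matrix (Entry d) (Entry d) (ℂ →L[ℂ] ℂ) :=
  Matrix.of fun p q => K p.1 q.1 (Matrix.single p.2.2 q.2.2 1) p.2.1 q.2.1 •
    ContinuousLinearMap.id ℂ ℂ

theorem herglotzEntry_star (μ : NCMeasure d) (p q : Entry d) :
    star (herglotzEntry μ p q) = herglotzEntry μ q p := by
  rw [herglotzEntry_eq, herglotzEntry_eq]
  simp
  ring

theorem tendsto_product_self :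
    Filter.Tendsto (fun T : Finset (Word d) => T ×ˢ T) Filter.atTop Filter.atTop := by
  refine Filter.tendsto_atTop.2 fun U => ?_
  filter_upwards [Filter.eventually_ge_atTop (U.image Prod.fst ∪ U.image Prod.snd)] with T hT
  intro x hx
  exact Finset.mem_product.2
    ⟨hT (Finset.mem_union_left _ (Finset.mem_image_of_mem _ hx)),
      hT (Finset.mem_union_right _ (Finset.mem_image_of_mem _ hx))⟩

theorem herglotzEntry_sum_nonneg (μ : NCMeasure d) (s : Finset (Entry d)) (v : Entry d → ℂ) :
    0 ≤ (∑ p ∈ s, ∑ q ∈ s, star (v p) * v q * herglotzEntry μ p q).re := by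
  have hlim : Filter.Tendsto (fun T : Finset (Word d) => ∑ p ∈ s, ∑ q ∈ s,
      star (v p) * v q * ∑ x ∈ T ×ˢ T, p.mon x.1 * star (q.mon x.2) *
        gnsForm μ (wordElt x.1) (wordElt x.2)) Filter.atTop
      (nhds (∑ p ∈ s, ∑ q ∈ s, star (v p) * v q * herglotzEntry μ p q)) :=
    tendsto_finsetSum _ fun p _ => tendsto_finsetSum _ fun q _ => Filter.Tendsto.const_mul _ <| by
      have h := hasSum_herglotzEntry μ p q
      rw [HasSum, SummationFilter.unconditional_filter] at h
      exact h.comp tendsto_product_self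
  refine ge_of_tendsto ((Complex.continuous_re.tendsto _).comp hlim)
    (Filter.Eventually.of_forall fun T => ?_)
  have h := (Complex.nonneg_iff.1 (gnsForm_self_nonneg μ
    (∑ p ∈ s, ∑ α ∈ T, (v p * star (p.mon α)) • wordElt α))).1
  rw [LinearMap.map_sum₂] at h
  refine h.trans_eq (congrArg Complex.re (Finset.sum_congr rfl fun p _ => ?_))
  rw [map_sum]
  refine Finset.sum_congr rfl fun q _ => ?_
  rw [Finset.sum_product, Finset.mul_sum, LinearMap.map_sum₂]
  refine Finset.sum_congr rfl fun α _ => ?_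
  rw [Finset.mul_sum, map_sum]
  refine Finset.sum_congr rfl fun β _ => ?_
  simp
  ring

/-- The free Herglotz kernel is positive. -/
theorem posSemidef_kernelMatrix (μ : NCMeasure d) :
    (kernelMatrix (herglotzKernel μ)).PosSemidef := by
  have happ (p q : Entry d) : kernelMatrix (herglotzKernel μ) p q =
    herglotzEntry μ p q • ContinuousLinearMap.id ℂ ℂ := rfl
  refine (List.TFAE.out RKHS.posSemidef_tfae 0 2).2 (And.intro ?_ fun v => ?_)
  · ext p q
    have hid : star (ContinuousLinearMap.id ℂ ℂ) = ContinuousLinearMap.id ℂ ℂ := star_one _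
    rw [Matrix.conjTranspose_apply, happ, happ, ← herglotzEntry_star, star_smul, hid, star_star]
  · refine (herglotzEntry_sum_nonneg μ v.support v).trans_eq (congrArg Complex.re ?_)
    refine Finset.sum_congr rfl fun p _ => Finset.sum_congr rfl fun q _ => ?_
    change _ = inner ℂ ((kernelMatrix (herglotzKernel μ) q p) (v p)) (v q)
    rw [happ, ← herglotzEntry_star]
    simp
    ring

instance (μ : NCMeasure d) : Fact (kernelMatrix (herglotzKernel μ)).PosSemidef :=
  ⟨posSemidef_kernelMatrix μ⟩

/-- The free Herglotz space of `μ`: the reproducing kernel Hilbert space of the NC kernel `K^μ`. -/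
abbrev HerglotzSpace (μ : NCMeasure d) : Type := RKHS.OfKernel (kernelMatrix (herglotzKernel μ))

/-- An element of the free Herglotz space as a matrix-valued function on the NC unit row-ball. -/
def HerglotzSpace.toNCFun {μ : NCMeasure d} (F : HerglotzSpace μ) : NCFun d :=
  fun Z => Matrix.of fun i j => F ⟨Z, i, j⟩

theorem szegoKernel_add (Z W : NCBall d) (P Q : Matrix (Fin Z.size) (Fin W.size) ℂ) :
    szegoKernel Z W (P + Q) = szegoKernel Z W P + szegoKernel Z W Q := by
  ext i k
  simp [szegoKernel_apply, add_mul, Finset.sum_add_distrib]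

theorem szegoKernel_smul (Z W : NCBall d) (c : ℂ) (P : Matrix (Fin Z.size) (Fin W.size) ℂ) :
    szegoKernel Z W (c • P) = c • szegoKernel Z W P := by
  ext i k
  simp [szegoKernel_apply, Finset.mul_sum, mul_assoc]

/-- The Herglotz kernel as a linear map in its matrix argument. -/
def herglotzKernelLinear (μ : NCMeasure d) (Z W : NCBall d) :
    Matrix (Fin Z.size) (Fin W.size) ℂ →ₗ[ℂ] Matrix (Fin Z.size) (Fin W.size) ℂ where
  toFun := herglotzKernel μ Z W
  map_add' P Q := by
    rw [herglotzKernel, herglotzKernel, herglotzKernel, ← smul_add, ← szegoKernel_add]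
    congr 2
    rw [Matrix.mul_add, Matrix.add_mul]
    abel
  map_smul' c P := by
    rw [herglotzKernel, herglotzKernel, RingHom.id_apply, Matrix.mul_smul, Matrix.smul_mul,
      ← smul_add, szegoKernel_smul, smul_comm]

theorem HerglotzSpace.toNCFun_injective (μ : NCMeasure d) :
    Function.Injective (HerglotzSpace.toNCFun (μ := μ)) := by
  intro F G h
  refine RKHS.ext fun p => ?_
  exact congrFun (congrFun (congrFun h p.1) p.2.1) p.2.2

/-- The kernel vector `K{Z, y, v}` of the free Herglotz space. -/
def kernelVector (μ : NCMeasure d) (Z : NCBall d) (y v : Fin Z.size → ℂ) : HerglotzSpace μ :=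
  ∑ i, ∑ j, (y i * star (v j)) •
    RKHS.kerFun (HerglotzSpace μ) (⟨Z, i, j⟩ : Entry d) (1 : ℂ)

/-- The reproducing property `⟨K{Z, y, v}, F⟩ = y* F(Z) v`. -/
theorem inner_kernelVector (μ : NCMeasure d) (Z : NCBall d) (y v : Fin Z.size → ℂ)
    (F : HerglotzSpace μ) :
    inner ℂ (kernelVector μ Z y v) F = star y ⬝ᵥ (F.toNCFun Z).mulVec v := by
  simp only [kernelVector, sum_inner, inner_smul_left, RKHS.kerFun_inner, dotProduct,
    Matrix.mulVec, Finset.mul_sum, HerglotzSpace.toNCFun, Matrix.of_apply, Pi.star_apply]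
  refine Finset.sum_congr rfl fun i _ => Finset.sum_congr rfl fun j _ => ?_
  simp
  ring

/-- The NC reproducing kernel: `⟨K{Z, y, v}, K{W, x, u}⟩ = y* K^μ(Z, W)[v u*] x`. -/
theorem inner_kernelVector_kernelVector (μ : NCMeasure d) (Z W : NCBall d)
    (y v : Fin Z.size → ℂ) (x u : Fin W.size → ℂ) :
    inner ℂ (kernelVector μ Z y v) (kernelVector μ W x u) =
      star y ⬝ᵥ (herglotzKernel μ Z W (Matrix.vecMulVec v (star u))).mulVec x := by
  have hlin : herglotzKernel μ Z W (Matrix.vecMulVec v (star u)) =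
      ∑ j, ∑ l, (v j * star (u l)) • herglotzKernel μ Z W (Matrix.single j l 1) := by
    change herglotzKernelLinear μ Z W _ = ∑ j, ∑ l, _ • herglotzKernelLinear μ Z W _
    conv_lhs => rw [Matrix.matrix_eq_sum_single (Matrix.vecMulVec v (star u))]
    simp only [map_sum, ← map_smul]
    refine Finset.sum_congr rfl fun j _ => Finset.sum_congr rfl fun l _ => ?_
    simp [Matrix.vecMulVec_apply]
  have hent (i : Fin Z.size) (j : Fin Z.size) :
      (kernelVector μ W x u).toNCFun Z i j = ∑ k, ∑ l, x k * star (u l) *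
        herglotzKernel μ Z W (Matrix.single j l 1) i k := by
    have h1 (k l) : RKHS.kerFun (HerglotzSpace μ) (⟨W, k, l⟩ : Entry d) (1 : ℂ) ⟨Z, i, j⟩ =
        herglotzKernel μ Z W (Matrix.single j l 1) i k := by
      rw [RKHS.kerFun_apply, RKHS.OfKernel.kernel_ofKernel]
      simp [kernelMatrix]
    have h2 : (kernelVector μ W x u).toNCFun Z i j =
        inner ℂ (RKHS.kerFun (HerglotzSpace μ) (⟨Z, i, j⟩ : Entry d) (1 : ℂ))
          (kernelVector μ W x u) := by
      rw [RKHS.kerFun_inner]; simp [HerglotzSpace.toNCFun]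
    rw [h2, kernelVector, inner_sum]
    refine Finset.sum_congr rfl fun k _ => ?_
    rw [inner_sum]
    refine Finset.sum_congr rfl fun l _ => ?_
    rw [inner_smul_right, RKHS.kerFun_inner, h1]
    simp
  rw [inner_kernelVector, hlin]
  simp only [dotProduct, Matrix.mulVec, hent, Matrix.sum_apply, Matrix.smul_apply, smul_eq_mul,
    Finset.sum_mul, Finset.mul_sum]
  refine Finset.sum_congr rfl fun i _ => ?_
  rw [Finset.sum_comm]
  refine Finset.sum_congr rfl fun k _ => Finset.sum_congr rfl fun j _ =>
    Finset.sum_congr rfl fun l _ => by ring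

end

end FreeHardy

/-! The theorem compares two Hilbert spaces attached to `μ`. The free Herglotz space of an NC
measure is a concrete model of its GNS space: the double power series of the kernel `K^μ` has the
Gram numbers `μ((L^α)* L^β)` as coefficients (`hasSum_herglotzEntry`). Suitable nilpotent points of
the row-ball isolate single coefficients, so some kernel functions are, up to scale, vectors
`wordVec μ α` with `⟨wordVec μ α, wordVec μ β⟩ = μ((L^α)* L^β)` (`inner_wordVec`). Every kernel
function is a norm limit of combinations of these (`tendsto_sum_wordVec`), so they span a dense
subspace.

For `μ + m` the GNS norm of `a` satisfies `‖a‖² = μ(a* a) + ‖a 1‖²`, which is exactly the norm `q_μ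
+ 1` on the form domain. Hence the class of `a` goes to `a 1` under a contraction `J` (`fockMap`)
from the Herglotz space of `μ + m` to the Fock space. Its adjoint sends `f` to the function `∑ f_α
Z^α` (`hasSum_adjoint_fockMap`), so the range of `J*` is the intersection of the Herglotz space with
the Hardy space. As the orthogonal complement of the range of `J*` is the kernel of `J`, density of
the intersection means injectivity of `J`.

Injectivity of `J` is closability of `q_μ`. A vector in the kernel of `J` is a limit of polynomials
that are Cauchy for `q_μ + 1` and tend to zero in the Fock space, and closability forces such a
limit to vanish (`fockMap_injective_of_isClosable`). Conversely, if `J` is injective, the Hilbert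
space norm transported to the range of `J` is the norm of a closed form that extends `q_μ`
(`isClosable_of_fockMap_injective`). -/

namespace FreeHardy

noncomputable section

variable {d : ℕ}

/-! ### Nilpotent points of the row-ball that isolate Taylor coefficients. -/

/-- The weighted path matrices of the word `l`: the `k`-th one has entry `1/2` at `(i, i + 1)` if the
`i`-th letter of `l` is `k`, and all its other entries vanish. -/
def pathCoord (l : List (Fin d)) (k : Fin d) : Matrix (Fin (l.length + 1)) (Fin (l.length + 1)) ℂ :=
  Matrix.of fun i j => if (i : ℕ) + 1 = j ∧ l[(i : ℕ)]? = some k then 1 / 2 else 0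

/-- In row `i` only one letter and one column contribute, with weight `1/2`; the last row is zero
for every letter. A weight below `1` in modulus keeps the point strictly inside the ball. -/
theorem sum_pathCoord_mul_conjTranspose (l : List (Fin d)) :
    ∑ k, pathCoord l k * (pathCoord l k).conjTranspose =
      Matrix.diagonal fun i : Fin (l.length + 1) => if (i : ℕ) < l.length then (1 / 4 : ℂ) else 0 := by
  ext i j
  simp only [Matrix.sum_apply, Matrix.mul_apply, Matrix.conjTranspose_apply, pathCoord,
    Matrix.of_apply, Matrix.diagonal_apply]
  by_cases hi : (i : ℕ) < l.length
  · rw [Finset.sum_eq_single l[(i : ℕ)], Finset.sum_eq_single ⟨i + 1, by omega⟩]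
    · by_cases hij : i = j
      · subst hij
        simp [hi]
        norm_num
      · have : (j : ℕ) ≠ i := fun h => hij (Fin.ext h.symm)
        simp [hij, this]
    · intro b _ hb
      have : (i : ℕ) + 1 ≠ b := fun h => hb (Fin.ext h.symm)
      simp [this]
    · simp
    · intro k _ hk
      have : l[(i : ℕ)] ≠ k := hk.symm
      simp [this, hi]
    · simp
  · simp [hi]

/-- The point of the NC unit row-ball given by the weighted path matrices of a word. -/
def pathPoint (l : List (Fin d)) : NCBall d where
  size := l.length + 1
  size_pos := l.length.succ_pos
  coord := pathCoord l
  posDef := by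
    rw [sum_pathCoord_mul_conjTranspose, ← Matrix.diagonal_one, Matrix.diagonal_sub]
    refine Matrix.PosDef.diagonal fun i => ?_
    split_ifs
    · have : (1 - 1 / 4 : ℂ) = ((3 / 4 : ℝ) : ℂ) := by push_cast; norm_num
      rw [this]
      exact Complex.zero_lt_real.2 (by norm_num)
    · simp

/-- Each factor of `Z^β` moves one step along the path and costs `1/2`, so `β` leads from `i` to the
end only if it spells the remaining letters. The last column is enough because the induction
prepends letters to `β`, which changes only the starting row. -/
theorem pathPoint_word_last (l : List (Fin d)) (β : Word d) (i : Fin (l.length + 1)) :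
    (pathPoint l).word β i (Fin.last l.length) =
      if FreeMonoid.toList β = l.drop i then (1 / 2 : ℂ) ^ β.length else 0 := by
  induction β using FreeMonoid.inductionOn' generalizing i with
  | one =>
    have hone : (pathPoint l).word 1 i (Fin.last l.length) =
        (1 : Matrix (Fin (l.length + 1)) (Fin (l.length + 1)) ℂ) i (Fin.last l.length) := by
      rw [map_one]
      rfl
    have : i = Fin.last l.length ↔ [] = l.drop i := by
      rw [eq_comm (a := []), List.drop_eq_nil_iff, Fin.ext_iff, Fin.val_last]
      omega
    rw [hone, Matrix.one_apply]
    simp only [this]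
    simp
  | of_mul k β ih =>
    have hmul : (pathPoint l).word (FreeMonoid.of k * β) i (Fin.last l.length) =
        ∑ j : Fin (l.length + 1), pathCoord l k i j *
          (pathPoint l).word β j (Fin.last l.length) := by
      rw [map_mul]
      have : (pathPoint l).word (FreeMonoid.of k) = pathCoord l k := by
        exact FreeMonoid.lift_eval_of _ _
      rw [this]
      rfl
    rw [hmul]
    simp only [ih, pathCoord, Matrix.of_apply]
    by_cases hi : (i : ℕ) < l.length
    · rw [Finset.sum_eq_single (⟨i + 1, by omega⟩ : Fin (l.length + 1)), List.drop_eq_getElem_cons hi]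
      · by_cases h1 : l[(i : ℕ)] = k
        · by_cases h2 : FreeMonoid.toList β = l.drop (i + 1) <;>
            simp [h1, h2, hi, FreeMonoid.length_mul, pow_add]
        · have h2 : ¬FreeMonoid.toList (FreeMonoid.of k * β) = l[(i : ℕ)] :: l.drop (i + 1) := by
            rw [FreeMonoid.toList_of_mul, List.cons.injEq]
            exact fun h => h1 h.1.symm
          rw [if_neg h2, if_neg, zero_mul]
          simp [h1, hi]
      · intro b _ hb
        have : (i : ℕ) + 1 ≠ b := fun h => hb (Fin.ext h.symm)
        simp [this]
      · simp
    -- At the end of the path no letter is left: the row vanishes, and a nonempty word cannot equal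
    -- the empty remainder.
    · have : l.length ≤ (i : ℕ) := by omega
      simp [this, List.drop_eq_nil_of_le this]

/-- The corner position of the path point of the word `α`, where the evaluation of a power series is
a multiple of its coefficient at `α`. -/
def coeffEntry (α : Word d) : Entry d :=
  ⟨pathPoint (FreeMonoid.toList α), (0 : Fin (_ + 1)), Fin.last _⟩

theorem coeffEntry_mon (α β : Word d) :
    (coeffEntry α).mon β = if β = α then (1 / 2 : ℂ) ^ α.length else 0 := by
  have h := pathPoint_word_last (FreeMonoid.toList α) β 0
  refine h.trans ?_
  by_cases hβ : β = α
  · simp [hβ]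
  · have : FreeMonoid.toList β ≠ FreeMonoid.toList α := fun h => hβ h
    simp [hβ]

/-! ### Word vectors: the free Herglotz space as GNS space. -/

/-- The kernel function of the free Herglotz space at a position `(Z, i, j)`. -/
def entryVec (μ : NCMeasure d) (p : Entry d) : HerglotzSpace μ :=
  RKHS.kerFun (HerglotzSpace μ) p (1 : ℂ)

theorem inner_entryVec (μ : NCMeasure d) (p : Entry d) (F : HerglotzSpace μ) :
    inner ℂ (entryVec μ p) F = F p := by
  rw [entryVec, RKHS.kerFun_inner]
  simp

theorem inner_entryVec_entryVec (μ : NCMeasure d) (p q : Entry d) :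
    inner ℂ (entryVec μ p) (entryVec μ q) = herglotzEntry μ p q := by
  rw [inner_entryVec, entryVec, RKHS.kerFun_apply, RKHS.OfKernel.kernel_ofKernel]
  simp [kernelMatrix, herglotzEntry]

theorem eq_of_forall_inner_entryVec (μ : NCMeasure d) {F G : HerglotzSpace μ}
    (h : ∀ p, inner ℂ (entryVec μ p) F = inner ℂ (entryVec μ p) G) : F = G :=
  RKHS.ext fun p => by simpa only [inner_entryVec] using h p

/-- The vector of the free Herglotz space that represents the class of `L^α` in the GNS space. -/
def wordVec (μ : NCMeasure d) (α : Word d) : HerglotzSpace μ :=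
  (2 : ℂ) ^ α.length • entryVec μ (coeffEntry α)

/-- In the double series of the kernel at `p` and `coeffEntry β`, only the slice with second word
`β` survives; the factor `2 ^ β.length` in `wordVec` cancels the weight of the path. -/
theorem hasSum_inner_entryVec_wordVec (μ : NCMeasure d) (p : Entry d) (β : Word d) :
    HasSum (fun α => p.mon α * gnsForm μ (wordElt α) (wordElt β))
      (inner ℂ (entryVec μ p) (wordVec μ β)) := by
  have hinj : Function.Injective fun α : Word d => (α, β) := Prod.mk_left_injective β
  have h := (hinj.hasSum_iff ?_).2 ((hasSum_herglotzEntry μ p (coeffEntry β)).mul_left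
    ((2 : ℂ) ^ β.length))
  · rw [wordVec, inner_smul_right, inner_entryVec_entryVec]
    convert! h using 2 with α
    simp only [Function.comp_apply, coeffEntry_mon, if_true, star_pow]
    have : (2 : ℂ) ^ β.length * (1 / 2) ^ β.length = 1 := by rw [← mul_pow]; simp
    have h2 : star (1 / 2 : ℂ) = 1 / 2 := by simp
    rw [h2]
    linear_combination (-(p.mon α * gnsForm μ (wordElt α) (wordElt β))) * this
  · rintro ⟨α, γ⟩ hx
    have : γ ≠ β := fun h => hx ⟨α, by rw [h]⟩
    simp [coeffEntry_mon, this]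

/-- Taking the path point of `α` as first argument collapses the remaining simple series to its term
at `α`. -/
theorem inner_wordVec (μ : NCMeasure d) (α β : Word d) :
    inner ℂ (wordVec μ α) (wordVec μ β) = gnsForm μ (wordElt α) (wordElt β) := by
  have h := hasSum_inner_entryVec_wordVec μ (coeffEntry α) β
  have h2 := h.unique (hasSum_single α fun γ hγ => by simp [coeffEntry_mon, hγ])
  rw [wordVec, inner_smul_left, h2, coeffEntry_mon, if_pos rfl, ← mul_assoc]
  rw [map_pow, Complex.conj_ofNat, ← mul_pow]
  norm_num

/-- The expansion of the kernel function at `p` along the words. -/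
theorem tendsto_sum_wordVec (μ : NCMeasure d) (p : Entry d) :
    Filter.Tendsto (fun T : Finset (Word d) => ∑ α ∈ T, star (p.mon α) • wordVec μ α)
      Filter.atTop (nhds (entryVec μ p)) := by
  set S : Finset (Word d) → HerglotzSpace μ := fun T => ∑ α ∈ T, star (p.mon α) • wordVec μ α
    with hS
  have hK := hasSum_herglotzEntry μ p p
  -- The cross term: the double series of `K(p, p)` summed in one word first, then over `T` in the
  -- other.
  have h1 : Filter.Tendsto (fun T => inner ℂ (entryVec μ p) (S T)) Filter.atTop
      (nhds (herglotzEntry μ p p)) := by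
    have h := ((Equiv.prodComm _ _).hasSum_iff.2 hK).prod_fiberwise
      (g := fun β => star (p.mon β) * inner ℂ (entryVec μ p) (wordVec μ β)) fun β => by
        convert! (hasSum_inner_entryVec_wordVec μ p β).mul_left (star (p.mon β)) using 2 with α
        simp
        ring
    rw [HasSum, SummationFilter.unconditional_filter] at h
    refine h.congr fun T => ?_
    simp [hS, inner_sum, inner_smul_right]
  -- The square term: the same series summed over the squares `T ×ˢ T`, which are cofinal among the
  -- finite sets of pairs.
  have h2 : Filter.Tendsto (fun T => inner ℂ (S T) (S T)) Filter.atTop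
      (nhds (herglotzEntry μ p p)) := by
    have h := hK
    rw [HasSum, SummationFilter.unconditional_filter] at h
    refine (h.comp tendsto_product_self).congr fun T => ?_
    simp only [Function.comp_apply, hS, sum_inner, inner_sum, inner_smul_left, inner_smul_right,
      inner_wordVec, Finset.sum_product, Finset.mul_sum]
    rw [Finset.sum_comm]
    refine Finset.sum_congr rfl fun α _ => Finset.sum_congr rfl fun β _ => ?_
    simp
    ring
  rw [tendsto_iff_norm_sub_tendsto_zero]
  -- Expanding the square gives the limit `K - 2K + K = 0` with `K` the real part of `herglotzEntry
  -- μ p p`.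
  have h3 : Filter.Tendsto (fun T => ‖S T - entryVec μ p‖ ^ 2) Filter.atTop (nhds 0) := by
    have e : ∀ T, ‖S T - entryVec μ p‖ ^ 2 = (inner ℂ (S T) (S T)).re -
        2 * (inner ℂ (entryVec μ p) (S T)).re + (herglotzEntry μ p p).re := by
      intro T
      rw [norm_sub_sq (𝕜 := ℂ), ← inner_entryVec_entryVec, inner_re_symm (𝕜 := ℂ),
        ← inner_self_eq_norm_sq (𝕜 := ℂ), ← inner_self_eq_norm_sq (𝕜 := ℂ)]
      rfl
    simp only [e]
    have := (((Complex.continuous_re.tendsto _).comp h2).sub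
      (((Complex.continuous_re.tendsto _).comp h1).const_mul 2)).add_const (herglotzEntry μ p p).re
    convert! this using 2
    ring
  have h4 := (Real.continuous_sqrt.tendsto 0).comp h3
  simpa [Function.comp_def, Real.sqrt_sq (norm_nonneg _)] using h4

/-! ### Polynomials and their density. -/

/-- The polynomial in the left shifts with the given coefficients. -/
def polyElt (d : ℕ) : (Word d →₀ ℂ) →ₗ[ℂ] freeDiskAlgebra d :=
  Finsupp.linearCombination ℂ wordElt

/-- The vector of the free Herglotz space that represents a polynomial in the left shifts. -/
def polyVec (μ : NCMeasure d) : (Word d →₀ ℂ) →ₗ[ℂ] HerglotzSpace μ :=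
  Finsupp.linearCombination ℂ (wordVec μ)

theorem inner_polyVec (μ : NCMeasure d) (c e : Word d →₀ ℂ) :
    inner ℂ (polyVec μ c) (polyVec μ e) = gnsForm μ (polyElt d c) (polyElt d e) := by
  simp only [polyVec, polyElt, Finsupp.linearCombination_apply, Finsupp.sum, sum_inner, inner_sum,
    inner_smul_left, inner_smul_right, inner_wordVec, map_sum, LinearMap.sum_apply,
    LinearMap.map_smulₛₗ, LinearMap.smul_apply, smul_eq_mul, RingHom.id_apply]

theorem norm_polyVec_sq (μ : NCMeasure d) (c : Word d →₀ ℂ) :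
    ‖polyVec μ c‖ ^ 2 = (gnsForm μ (polyElt d c) (polyElt d c)).re := by
  rw [← inner_polyVec, ← inner_self_eq_norm_sq (𝕜 := ℂ)]
  rfl

/-- The closed span contains every kernel function, so a vector orthogonal to it vanishes at every
position. -/
theorem denseRange_polyVec (μ : NCMeasure d) : DenseRange (polyVec μ) := by
  have hK (p : Entry d) : entryVec μ p ∈ (LinearMap.range (polyVec μ)).topologicalClosure := by
    refine mem_closure_of_tendsto (tendsto_sum_wordVec μ p) (Filter.Eventually.of_forall fun T => ?_)
    refine Submodule.sum_mem _ fun α _ => Submodule.smul_mem _ _ ⟨Finsupp.single α 1, ?_⟩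
    simp [polyVec]
  have h : (LinearMap.range (polyVec μ)).topologicalClosure = ⊤ := by
    rw [Submodule.topologicalClosure_eq_top_iff, Submodule.eq_bot_iff]
    intro F hF
    rw [← Submodule.orthogonal_closure] at hF
    refine eq_of_forall_inner_entryVec μ fun p => ?_
    rw [inner_zero_right]
    exact hF _ (hK p)
  exact Submodule.dense_iff_topologicalClosure_eq_top.2 h

theorem denseRange_polyElt : DenseRange (polyElt d) := by
  intro a
  rw [closure_subtype]
  refine closure_mono ?_ a.2
  intro x hx
  have := adjoin_le_span hx
  rw [← Finsupp.range_linearCombination] at this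
  obtain ⟨c, rfl⟩ := this
  refine ⟨polyElt d c, ⟨c, rfl⟩, ?_⟩
  simp [polyElt, Finsupp.linearCombination_apply, Finsupp.sum, wordElt]

/-! ### Boundedness from positivity, and the GNS map on the whole free disk algebra. -/

theorem re_apply_le_of_isSelfAdjoint (μ : NCMeasure d) (x : freeDiskSystem d)
    (hx : IsSelfAdjoint (x : Fock d →L[ℂ] Fock d)) :
    (μ x).re ≤ ‖(x : Fock d →L[ℂ] Fock d)‖ * (moment μ 1).re := by
  -- The order bound `x ≤ ‖x‖ I`, with `I` written as `L^∅` so that its value under `μ` is `moment μ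
  -- 1`.
  have hle : x ≤ (‖(x : Fock d →L[ℂ] Fock d)‖ : ℂ) •
      (⟨leftShiftWord 1, mem_system_of_mem (leftShiftWord_mem 1)⟩ : freeDiskSystem d) := by
    change (x : Fock d →L[ℂ] Fock d) ≤ (‖(x : Fock d →L[ℂ] Fock d)‖ : ℂ) • leftShiftWord 1
    have h := hx.le_algebraMap_norm_self
    rwa [Algebra.algebraMap_eq_smul_one, ← Complex.coe_smul, ← map_one leftShiftWord] at h
  have h := (Complex.le_def.1 (OrderHomClass.mono μ hle)).1
  rw [map_smul, smul_eq_mul, Complex.re_ofReal_mul] at h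
  exact h

/-- `a* b` as an element of the free disk system. -/
def starMul (a b : freeDiskAlgebra d) : freeDiskSystem d :=
  ⟨star (a : Fock d →L[ℂ] Fock d) * b, star_mul_mem_system a.2 b.2⟩

theorem gnsForm_apply (μ : NCMeasure d) (a b : freeDiskAlgebra d) :
    gnsForm μ a b = μ (starMul a b) := rfl

/-- Serves twice: used in both orders it makes `a ↦ μ(a* a)` norm continuous, and with `b = 0` it
bounds the GNS norm by the operator norm. This is how identities on polynomials pass to the closure.
-/
theorem gnsForm_sub_re_le (μ : NCMeasure d) (a b : freeDiskAlgebra d) :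
    (gnsForm μ a a).re - (gnsForm μ b b).re ≤
      ‖star (a : Fock d →L[ℂ] Fock d) * a - star (b : Fock d →L[ℂ] Fock d) * b‖ *
        (moment μ 1).re := by
  have hs : IsSelfAdjoint
      (star (a : Fock d →L[ℂ] Fock d) * a - star (b : Fock d →L[ℂ] Fock d) * b) :=
    (IsSelfAdjoint.star_mul_self (a : Fock d →L[ℂ] Fock d)).sub
      (IsSelfAdjoint.star_mul_self (b : Fock d →L[ℂ] Fock d))
  rw [gnsForm_apply, gnsForm_apply, ← Complex.sub_re, ← map_sub]
  exact re_apply_le_of_isSelfAdjoint μ (starMul a a - starMul b b) hs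

theorem continuous_gnsForm_self (μ : NCMeasure d) :
    Continuous fun a : freeDiskAlgebra d => (gnsForm μ a a).re := by
  refine continuous_iff_continuousAt.2 fun b => ?_
  rw [ContinuousAt, tendsto_iff_norm_sub_tendsto_zero]
  have hc : Continuous fun a : freeDiskAlgebra d =>
      ‖star (a : Fock d →L[ℂ] Fock d) * a - star (b : Fock d →L[ℂ] Fock d) * b‖ *
        (moment μ 1).re := by fun_prop
  refine squeeze_zero (fun a => norm_nonneg _) (fun a => ?_) (by simpa using hc.tendsto b)
  rw [Real.norm_eq_abs, abs_sub_le_iff]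
  refine ⟨gnsForm_sub_re_le μ a b, ?_⟩
  rw [norm_sub_rev]
  exact gnsForm_sub_re_le μ b a

theorem norm_polyVec_le (μ : NCMeasure d) (c : Word d →₀ ℂ) :
    ‖polyVec μ c‖ ≤ √(moment μ 1).re * ‖polyElt d c‖ := by
  have hm : 0 ≤ (moment μ 1).re := (Complex.nonneg_iff.1 (moment_one_nonneg μ)).1
  refine le_of_sq_le_sq ?_ (by positivity)
  rw [norm_polyVec_sq, mul_pow, Real.sq_sqrt hm]
  have h := gnsForm_sub_re_le μ (polyElt d c) 0
  simp only [map_zero, Complex.zero_re, sub_zero, ZeroMemClass.coe_zero, mul_zero] at h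
  calc _ ≤ _ := h
    _ = _ := by
      rw [CStarRing.norm_star_mul_self (x := (polyElt d c : Fock d →L[ℂ] Fock d)), sq, mul_comm]
      rfl

/-- The canonical map of the free disk algebra to its GNS space, realised as the free Herglotz
space. -/
def gnsMap (μ : NCMeasure d) : freeDiskAlgebra d →L[ℂ] HerglotzSpace μ :=
  (polyVec μ).extendOfNorm (polyElt d)

theorem gnsMap_polyElt (μ : NCMeasure d) (c : Word d →₀ ℂ) :
    gnsMap μ (polyElt d c) = polyVec μ c :=
  LinearMap.extendOfNorm_eq (denseRange_polyElt (d := d)) ⟨_, norm_polyVec_le μ⟩ c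

theorem norm_gnsMap_sq (μ : NCMeasure d) (a : freeDiskAlgebra d) :
    ‖gnsMap μ a‖ ^ 2 = (gnsForm μ a a).re := by
  refine (denseRange_polyElt (d := d)).induction_on (p := fun a => ‖gnsMap μ a‖ ^ 2 = (gnsForm μ a a).re) a
    (isClosed_eq (by fun_prop) (continuous_gnsForm_self μ)) fun c => ?_
  rw [gnsMap_polyElt, norm_polyVec_sq]

theorem inner_gnsMap_self (μ : NCMeasure d) (a : freeDiskAlgebra d) :
    inner ℂ (gnsMap μ a) (gnsMap μ a) = gnsForm μ a a := by
  rw [inner_self_eq_norm_sq_to_K]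
  apply Complex.ext
  · rw [← norm_gnsMap_sq]
    norm_cast
  · rw [(Complex.nonneg_iff.1 (gnsForm_self_nonneg μ a)).2.symm]
    norm_cast

/-- Polarization: two sesquilinear forms that agree on the diagonal are compared at `a + b` and `a +
i b`. -/
theorem inner_gnsMap (μ : NCMeasure d) (a b : freeDiskAlgebra d) :
    inner ℂ (gnsMap μ a) (gnsMap μ b) = gnsForm μ a b := by
  have h1 := inner_gnsMap_self μ (a + b)
  have h2 := inner_gnsMap_self μ (a + Complex.I • b)
  have ha := inner_gnsMap_self μ a
  have hb := inner_gnsMap_self μ b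
  simp only [map_add, map_smul, inner_add_left, inner_add_right, inner_smul_left, inner_smul_right,
    LinearMap.add_apply, LinearMap.map_smulₛₗ, LinearMap.smul_apply, smul_eq_mul, Complex.conj_I]
    at h1 h2
  linear_combination (1 / 2) * (h1 - ha - hb) - (Complex.I / 2) * (h2 - ha) +
    (Complex.I / 2) * (-Complex.I * Complex.I) * hb +
    ((inner ℂ (gnsMap μ a) (gnsMap μ b) - gnsForm μ a b) / 2 -
      (inner ℂ (gnsMap μ b) (gnsMap μ a) - gnsForm μ b a) / 2) * Complex.I_mul_I

/-! ### The contraction `J` to the Fock space, its adjoint, and the Hardy space. -/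

theorem gnsForm_add_lebesgue (μ : NCMeasure d) (a b : freeDiskAlgebra d) :
    gnsForm (μ + lebesgue d) a b = gnsForm μ a b + inner ℂ (symbol d a) (symbol d b) := by
  change (μ + lebesgue d) _ = μ _ + _
  rw [PositiveLinearMap.add_apply]
  congr 1
  change inner ℂ vacuum ((star (a : Fock d →L[ℂ] Fock d) * (b : Fock d →L[ℂ] Fock d)) vacuum) =
    inner ℂ ((a : Fock d →L[ℂ] Fock d) vacuum) ((b : Fock d →L[ℂ] Fock d) vacuum)
  rw [mul_apply_eq_comp, ContinuousLinearMap.star_eq_adjoint,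
    ContinuousLinearMap.adjoint_inner_right]

/-- Dropping the nonnegative term `μ(a* a)` from the squared GNS norm of `μ + m` leaves `‖a 1‖²`. -/
theorem norm_symbol_le (μ : NCMeasure d) (c : Word d →₀ ℂ) :
    ‖(symbol d ∘ₗ polyElt d) c‖ ≤ 1 * ‖polyVec (μ + lebesgue d) c‖ := by
  rw [one_mul]
  refine le_of_sq_le_sq ?_ (norm_nonneg _)
  rw [norm_polyVec_sq, gnsForm_add_lebesgue, Complex.add_re, ← inner_self_eq_norm_sq (𝕜 := ℂ)]
  exact le_add_of_nonneg_left (Complex.nonneg_iff.1 (gnsForm_self_nonneg μ _)).1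

/-- The contraction of the GNS space of `μ + m` to the Fock space that sends the class of `a` to
`a 1`. -/
def fockMap (μ : NCMeasure d) : HerglotzSpace (μ + lebesgue d) →L[ℂ] Fock d :=
  (symbol d ∘ₗ polyElt d).extendOfNorm (polyVec (μ + lebesgue d))

theorem fockMap_polyVec (μ : NCMeasure d) (c : Word d →₀ ℂ) :
    fockMap μ (polyVec (μ + lebesgue d) c) = symbol d (polyElt d c) :=
  LinearMap.extendOfNorm_eq (denseRange_polyVec _) ⟨1, norm_symbol_le μ⟩ c

theorem continuous_symbol : Continuous (symbol d) :=
  (ContinuousLinearMap.apply ℂ (Fock d) (vacuum (d := d))).continuous.comp continuous_subtype_val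

theorem fockMap_gnsMap (μ : NCMeasure d) (a : freeDiskAlgebra d) :
    fockMap μ (gnsMap (μ + lebesgue d) a) = symbol d a := by
  refine (denseRange_polyElt (d := d)).induction_on
    (p := fun a => fockMap μ (gnsMap (μ + lebesgue d) a) = symbol d a) a
    (isClosed_eq (by fun_prop) continuous_symbol) fun c => ?_
  rw [gnsMap_polyElt, fockMap_polyVec]

theorem fockMap_wordVec (μ : NCMeasure d) (α : Word d) :
    fockMap μ (wordVec (μ + lebesgue d) α) = lp.single 2 α (1 : ℂ) := by
  have h := fockMap_polyVec μ (Finsupp.single α 1)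
  simp only [polyVec, polyElt, Finsupp.linearCombination_single, one_smul] at h
  rw [h]
  exact symbol_leftShiftWord α

/-- The adjoint of `fockMap μ` sends `f` to the power series with coefficients `f`. -/
theorem hasSum_adjoint_fockMap (μ : NCMeasure d) (f : Fock d) (p : Entry d) :
    HasSum (fun α => f α * p.mon α) ((fockMap μ).adjoint f p) := by
  -- `J` sends the partial sums of the kernel function to `∑ conj(p.mon α) e_α`; pairing these with
  -- `f` gives the partial sums of the power series.
  have h := ((fockMap μ).continuous.tendsto _).comp (tendsto_sum_wordVec (μ + lebesgue d) p)
  have h2 := h.inner (𝕜 := ℂ) (tendsto_const_nhds (x := f))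
  rw [← ContinuousLinearMap.adjoint_inner_right, inner_entryVec] at h2
  rw [HasSum, SummationFilter.unconditional_filter]
  refine h2.congr fun T => ?_
  simp only [Function.comp_apply, map_sum, map_smul, fockMap_wordVec, sum_inner, inner_smul_left]
  refine Finset.sum_congr rfl fun α _ => ?_
  rw [lp.inner_single_left]
  simp [mul_comm]

theorem toNCFun_mem_freeHardySpace_iff (μ : NCMeasure d) (F : HerglotzSpace (μ + lebesgue d)) :
    F.toNCFun ∈ freeHardySpace d ↔ F ∈ Set.range (fockMap μ).adjoint := by
  constructor
  · rintro ⟨f, hf⟩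
    -- Elements of the Herglotz space are determined by their values, so it is enough that `F` and
    -- `J* f` are sums of the same series at each position.
    refine ⟨f, RKHS.ext fun p => (hasSum_adjoint_fockMap μ f p).unique ?_⟩
    exact Pi.hasSum.1 (Pi.hasSum.1 (hf p.1) p.2.1) p.2.2
  · rintro ⟨f, rfl⟩
    exact ⟨f, fun Z => Pi.hasSum.2 fun i => Pi.hasSum.2 fun j =>
      hasSum_adjoint_fockMap μ f ⟨Z, i, j⟩⟩

theorem dense_range_adjoint_fockMap_iff (μ : NCMeasure d) :
    Dense (Set.range (fockMap μ).adjoint) ↔ Function.Injective (fockMap μ) := by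
  have h := ContinuousLinearMap.orthogonal_range (fockMap μ).adjoint
  rw [ContinuousLinearMap.adjoint_adjoint] at h
  have h2 : Dense (Set.range (fockMap μ).adjoint) ↔
      (fockMap μ).adjoint.range.topologicalClosure = ⊤ :=
    Submodule.dense_iff_topologicalClosure_eq_top (s := (fockMap μ).adjoint.range)
  rw [h2, Submodule.topologicalClosure_eq_top_iff, h, LinearMap.ker_eq_bot]
  rfl

/-! ### Closability of `q_μ` implies injectivity of `J`. -/

theorem normSqAddOne_toeplitzForm (μ : NCMeasure d) (a : freeDiskAlgebra d) :
    (toeplitzForm μ).normSqAddOne (symbolEquiv d a) = ‖gnsMap (μ + lebesgue d) a‖ ^ 2 := by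
  change ((toeplitzForm μ).form (symbolEquiv d a) (symbolEquiv d a)).re + ‖symbol d a‖ ^ 2 = _
  rw [norm_gnsMap_sq, gnsForm_add_lebesgue, Complex.add_re, toeplitzForm_symbol,
    ← inner_self_eq_norm_sq (𝕜 := ℂ)]
  rfl

theorem PosForm.normSqAddOne_inclusion {H : Type*} [NormedAddCommGroup H] [InnerProductSpace ℂ H]
    {q r : PosForm H} (h : r.Extends q) (x : q.domain) :
    r.normSqAddOne (Submodule.inclusion h.le x) = q.normSqAddOne x := by
  rw [PosForm.normSqAddOne, h.eq]
  rfl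

theorem PosForm.norm_sq_le_normSqAddOne {H : Type*} [NormedAddCommGroup H] [InnerProductSpace ℂ H]
    (q : PosForm H) (x : q.domain) : ‖(x : H)‖ ^ 2 ≤ q.normSqAddOne x :=
  le_add_of_nonneg_left (Complex.nonneg_iff.1 (q.nonneg x)).1

/-- A sequence that is Cauchy in the norm of a closed extension and tends to zero in the ambient
space tends to zero in the norm of the form. -/
theorem PosForm.IsClosable.tendsto_zero {H : Type*} [NormedAddCommGroup H] [InnerProductSpace ℂ H]
    {q : PosForm H} (h : q.IsClosable) (x : ℕ → q.domain)
    (hx : ∀ ε > 0, ∃ N, ∀ m ≥ N, ∀ n ≥ N, q.normSqAddOne (x m - x n) < ε)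
    (hx0 : Filter.Tendsto (fun n => (x n : H)) Filter.atTop (nhds 0)) :
    Filter.Tendsto (fun n => q.normSqAddOne (x n)) Filter.atTop (nhds 0) := by
  obtain ⟨r, hr, hclosed⟩ := h
  obtain ⟨z, hz⟩ := hclosed (fun n => Submodule.inclusion hr.le (x n)) (by
    simpa only [← map_sub, PosForm.normSqAddOne_inclusion hr] using hx)
  have hyz : Filter.Tendsto (fun n => (x n : H)) Filter.atTop (nhds z) := by
    rw [tendsto_iff_norm_sub_tendsto_zero]
    have h1 := (Real.continuous_sqrt.tendsto 0).comp hz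
    rw [Real.sqrt_zero] at h1
    refine squeeze_zero (fun n => norm_nonneg _) (fun n => ?_) h1
    exact Real.le_sqrt_of_sq_le (r.norm_sq_le_normSqAddOne (Submodule.inclusion hr.le (x n) - z))
  -- The norm of the closed extension dominates the ambient norm, so its limit is also the ambient
  -- limit.
  have hz0 : z = 0 := Subtype.ext (tendsto_nhds_unique hyz hx0)
  refine hz.congr fun n => ?_
  rw [hz0, sub_zero, PosForm.normSqAddOne_inclusion hr]

theorem fockMap_injective_of_isClosable (μ : NCMeasure d) (h : (toeplitzForm μ).IsClosable) :
    Function.Injective (fockMap μ) := by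
  refine (injective_iff_map_eq_zero _).2 fun F hF => ?_
  obtain ⟨x, hx, hlim⟩ := mem_closure_iff_seq_limit.1 (denseRange_polyVec (μ + lebesgue d) F)
  choose c hc using hx
  have hG (n : ℕ) : gnsMap (μ + lebesgue d) (polyElt d (c n)) = x n := by
    rw [gnsMap_polyElt, hc]
  -- The approximants converge to `F` in the GNS space, hence are Cauchy for `q_μ + 1`; their images
  -- under `J` tend to `J F = 0`.
  have hx0 := h.tendsto_zero (fun n => symbolEquiv d (polyElt d (c n))) (fun ε hε => by
    obtain ⟨N, hN⟩ := Metric.cauchySeq_iff.1 hlim.cauchySeq (√ε) (Real.sqrt_pos.2 hε)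
    refine ⟨N, fun m hm n hn => ?_⟩
    have e := normSqAddOne_toeplitzForm μ (polyElt d (c m) - polyElt d (c n))
    rw [map_sub, map_sub, hG, hG] at e
    refine e.trans_lt ?_
    rw [← Real.lt_sqrt (norm_nonneg _), ← dist_eq_norm]
    exact hN m hm n hn) (by
    have h1 := ((fockMap μ).continuous.tendsto F).comp hlim
    rw [hF] at h1
    refine h1.congr fun n => ?_
    rw [Function.comp_apply, ← hc, fockMap_polyVec]
    rfl)
  have hx1 : Filter.Tendsto (fun n => ‖x n‖ ^ 2) Filter.atTop (nhds 0) := by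
    refine hx0.congr fun n => ?_
    rw [normSqAddOne_toeplitzForm, hG]
  have := tendsto_nhds_unique (hlim.norm.pow 2) hx1
  simpa using this

/-! ### Injectivity of `J` yields a closed extension of `q_μ`. -/

/-- The form on the range of an injective contraction `J : K → H` that is the inner product of `K`
minus the inner product of `H`. -/
def PosForm.ofContraction {K H : Type*} [NormedAddCommGroup K] [InnerProductSpace ℂ K]
    [NormedAddCommGroup H] [InnerProductSpace ℂ H] (J : K →L[ℂ] H) (hJ : Function.Injective J)
    (hd : DenseRange J) (hle : ∀ x, ‖J x‖ ≤ ‖x‖) : PosForm H where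
  domain := J.range
  dense_domain := hd
  form := LinearMap.mk₂'ₛₗ (starRingEnd ℂ) (RingHom.id ℂ)
    (fun x y => inner ℂ ((LinearEquiv.ofInjective J.toLinearMap hJ).symm x)
      ((LinearEquiv.ofInjective J.toLinearMap hJ).symm y) - inner ℂ (x : H) (y : H))
    (fun x₁ x₂ y => by simp only [map_add, inner_add_left, Submodule.coe_add]; ring)
    (fun c x y => by simp only [map_smul, inner_smul_left, Submodule.coe_smul, smul_eq_mul]; ring)
    (fun x y₁ y₂ => by simp only [map_add, inner_add_right, Submodule.coe_add]; ring)
    (fun c x y => by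
      simp only [map_smul, inner_smul_right, Submodule.coe_smul, smul_eq_mul, RingHom.id_apply]
      ring)
  nonneg x := by
    obtain ⟨x, rfl⟩ := (LinearEquiv.ofInjective J.toLinearMap hJ).surjective x
    rw [LinearMap.mk₂'ₛₗ_apply, LinearEquiv.symm_apply_apply, LinearEquiv.ofInjective_apply,
      inner_self_eq_norm_sq_to_K, inner_self_eq_norm_sq_to_K]
    have h : ‖J x‖ ^ 2 ≤ ‖x‖ ^ 2 := by gcongr; exact hle x
    have h2 : (0 : ℂ) ≤ ((‖x‖ ^ 2 - ‖J x‖ ^ 2 : ℝ) : ℂ) := Complex.zero_le_real.2 (sub_nonneg.2 h)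
    push_cast at h2
    exact h2

section ofContraction

variable {K H : Type*} [NormedAddCommGroup K] [InnerProductSpace ℂ K]
  [NormedAddCommGroup H] [InnerProductSpace ℂ H] (J : K →L[ℂ] H) (hJ : Function.Injective J)
  (hd : DenseRange J) (hle : ∀ x, ‖J x‖ ≤ ‖x‖)

theorem PosForm.ofContraction_form (x y : (PosForm.ofContraction J hJ hd hle).domain) (u v : K)
    (hx : J u = x) (hy : J v = y) :
    (PosForm.ofContraction J hJ hd hle).form x y = inner ℂ u v - inner ℂ (J u) (J v) := by
  have hx' : x = LinearEquiv.ofInjective J.toLinearMap hJ u := Subtype.ext hx.symm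
  have hy' : y = LinearEquiv.ofInjective J.toLinearMap hJ v := Subtype.ext hy.symm
  subst hx' hy'
  change inner ℂ ((LinearEquiv.ofInjective J.toLinearMap hJ).symm _)
    ((LinearEquiv.ofInjective J.toLinearMap hJ).symm _) - inner ℂ (J u) (J v) = _
  rw [LinearEquiv.symm_apply_apply, LinearEquiv.symm_apply_apply]

/-- The subtracted inner product of `H` is restored by the `+ 1`, so `J` is isometric onto the form
domain. Closedness of the form is therefore completeness of `K`. -/
theorem PosForm.normSqAddOne_ofContraction (x : (PosForm.ofContraction J hJ hd hle).domain) (u : K)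
    (hx : J u = x) : (PosForm.ofContraction J hJ hd hle).normSqAddOne x = ‖u‖ ^ 2 := by
  rw [PosForm.normSqAddOne, PosForm.ofContraction_form J hJ hd hle x x u u hx hx, Complex.sub_re,
    ← inner_self_eq_norm_sq (𝕜 := ℂ) u]
  have : ‖x‖ = ‖J u‖ := by rw [hx]; rfl
  rw [this, ← inner_self_eq_norm_sq (𝕜 := ℂ) (J u)]
  exact sub_add_cancel _ _

theorem PosForm.isClosed_ofContraction [CompleteSpace K] :
    (PosForm.ofContraction J hJ hd hle).IsClosed := by
  intro x hx
  choose u hu using fun n => (x n).2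
  have hu' (n : ℕ) : J (u n) = x n := hu n
  have hcauchy : CauchySeq u := by
    refine Metric.cauchySeq_iff.2 fun ε hε => ?_
    obtain ⟨N, hN⟩ := hx (ε ^ 2) (by positivity)
    refine ⟨N, fun m hm n hn => ?_⟩
    have h := hN m hm n hn
    rw [PosForm.normSqAddOne_ofContraction J hJ hd hle _ (u m - u n)
      (by rw [map_sub, hu', hu']; rfl)] at h
    rw [dist_eq_norm]
    exact lt_of_pow_lt_pow_left₀ 2 hε.le h
  obtain ⟨v, hv⟩ := cauchySeq_tendsto_of_complete hcauchy
  refine ⟨⟨J v, v, rfl⟩, ?_⟩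
  have h := (tendsto_iff_norm_sub_tendsto_zero.1 hv).pow 2
  rw [zero_pow two_ne_zero] at h
  refine h.congr fun n => ?_
  rw [PosForm.normSqAddOne_ofContraction J hJ hd hle _ (u n - v) (by rw [map_sub, hu']; rfl)]

end ofContraction

theorem norm_fockMap_le (μ : NCMeasure d) (F : HerglotzSpace (μ + lebesgue d)) :
    ‖fockMap μ F‖ ≤ ‖F‖ := by
  simpa [fockMap] using LinearMap.norm_extendOfNorm_apply_le (denseRange_polyVec (μ + lebesgue d)) 1
    (norm_symbol_le μ) F

theorem denseRange_fockMap (μ : NCMeasure d) : DenseRange (fockMap μ) := by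
  refine dense_range_symbol.mono ?_
  rintro _ ⟨a, rfl⟩
  exact ⟨_, fockMap_gnsMap μ a⟩

/-- On classes of algebra elements the difference of inner products is `(μ + m)(a* b) - m(a* b) =
μ(a* b)`. The domain of `q_μ` is the whole free disk algebra, so `gnsMap` is needed here and not
only polynomials. -/
theorem isClosable_of_fockMap_injective (μ : NCMeasure d) (h : Function.Injective (fockMap μ)) :
    (toeplitzForm μ).IsClosable := by
  refine ⟨PosForm.ofContraction (fockMap μ) h (denseRange_fockMap μ) (norm_fockMap_le μ),
    ⟨?_, fun x y => ?_⟩, PosForm.isClosed_ofContraction _ _ _ _⟩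
  · rintro _ ⟨a, rfl⟩
    exact ⟨_, fockMap_gnsMap μ a⟩
  · obtain ⟨a, rfl⟩ := (symbolEquiv d).surjective x
    obtain ⟨b, rfl⟩ := (symbolEquiv d).surjective y
    rw [PosForm.ofContraction_form _ _ _ _ _ _ (gnsMap (μ + lebesgue d) a)
      (gnsMap (μ + lebesgue d) b) (fockMap_gnsMap μ a) (fockMap_gnsMap μ b), inner_gnsMap,
      gnsForm_add_lebesgue, fockMap_gnsMap, fockMap_gnsMap, add_sub_cancel_right,
      toeplitzForm_symbol]

end

end FreeHardy

theorem corollary4p1 (d : ℕ) (μ : FreeHardy.NCMeasure d) :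
    μ.IsAbsolutelyContinuous ↔
      Dense {F : FreeHardy.HerglotzSpace (μ + FreeHardy.lebesgue d) |
        F.toNCFun ∈ FreeHardy.freeHardySpace d} := by
  have h : {F : FreeHardy.HerglotzSpace (μ + FreeHardy.lebesgue d) |
      F.toNCFun ∈ FreeHardy.freeHardySpace d} = Set.range (FreeHardy.fockMap μ).adjoint :=
    Set.ext fun F => FreeHardy.toNCFun_mem_freeHardySpace_iff μ F
  rw [h, FreeHardy.dense_range_adjoint_fockMap_iff]
  exact ⟨FreeHardy.fockMap_injective_of_isClosable μ, FreeHardy.isClosable_of_fockMap_injective μ⟩
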